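/- **Notation.** For an even integer $N\ge 1$ put $h=\sqrt2\,N^{-1/2}$ and $A_h=h\mathbb Z\cap[-\frac1h,\frac1h]$, and for $u:h\mathbb Z\to\mathbb C$ let $\|u\|_{\ell^2(h\mathbb Z)}^2=h\sum_{a\in h\mathbb Z}|u(a)|^2$. Write $\langle x\rangle=(1+x^2)^{1/2}$. For $n\in\mathbb N$ let $\Sigma^n(\mathbb R)$ be the space of $\psi\in L^2(\mathbb R)$ (complex valued) with $\|\psi\|_{\Sigma^n}:=\|\psi\|_{H^n(\mathbb R)}+\|\langle x\rangle^n\psi\|_{L^2(\mathbb R)}<\infty$. For $f$ with a continuous representative (e.g. $f\in H^1(\mathbb R)$), $\pi_hf:h\mathbb Z\to\mathbb C$ is the restriction of that representative to $h\mathbb Z$. Let $Hg=-g''+x^2g$ be the harmonic oscillator, and let $H_h$ be the operator $$H_hu(a)=-\tfrac1{h^2}\sqrt{(1+ah+h^2)(1-ah)}\,u(a+h)-\tfrac1{h^2}\sqrt{(1-ah+h^2)(1+ah)}\,u(a-h)+\Big(1+\tfrac2{h^2}\Big)u(a)$$ for $a\in A_h$, and $H_hu(a)=0$ for $a\in h\mathbb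 Z\setminus A_h$. Let $\rho_h(a)=\frac1{h2^N}\binom{N}{N/2+a/h}$ for $a\in A_h$ and $\rho_h(a)=0$ for $a\in h\mathbb Z\setminus A_h$. The scaled Kravchuk polynomials are defined by $k_{0,h}=1$, $k_{1,h}(x)=2x$ and $k_{n+1,h}(x)=2x\,k_{n,h}(x)-2n\big(1-h^2\tfrac{n-1}2\big)k_{n-1,h}(x)$ for $n\ge1$, and the Kravchuk functions, for $0\le n\le N$, by $$\varphi_{n,h}(a)=\frac1{h^n}\sqrt{\frac{(N-n)!}{N!\,n!}}\;k_{n,h}(a)\sqrt{\rho_h(a)},\qquad a\in h\mathbb Z.$$ The Hermite functions are $\psi_n(x)=\pi^{-1/4}2^{-n/2}(n!)^{-1/2}e^{-x^2/2}H_n(x)$, where $H_0=1$, $H_1(x)=2x$ and $H_{n+1}(x)=2xH_n(x)-2nH_{n-1}(x)$ for $n\ge1$. **Theorem 2.** (i) There exist constants $C$ and $N_0$ such that for all even $N\ge N_0$, with $h=\sqrt2\,N^{-1/2}$, and all $g\in\Sigma^5(\mathbb R)$, $$\|\pi_h(Hg)-H_h(\pi_hg)\|_{\ell^2(h\mathbb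 Z)}\le C\,h^2\,\|g\|_{\Sigma^5(\mathbb R)}.$$ (ii) For all $\delta\in(0,1)$ and $\sigma\ge0$ there exist constants $C$ and $N_0$ such that for all even $N\ge N_0$, with $h=\sqrt2\,N^{-1/2}$, $$\Big\|\langle a\rangle^\sigma\Big(\rho_h(a)-\tfrac1{\sqrt\pi}e^{-a^2}\Big)\Big\|_{\ell^2(h\mathbb Z)}\le C\,h^{2-\delta},$$ and, for all integers $0\le n\le\frac13\,\delta\,|\log h|$, $$\big\|\langle a\rangle^\sigma(\varphi_{n,h}-\pi_h\psi_n)\big\|_{\ell^2(h\mathbb Z)}\le C\,h^{2-\delta}.$$ -/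

import Mathlib

open MeasureTheory
open scoped ENNReal ContDiff

noncomputable section

namespace Kravchuk

/-- The Japanese bracket `⟨x⟩ = (1 + x²)^{1/2}`. -/
def japanese (x : ℝ) : ℝ := √(1 + x ^ 2)

/-! ### Weak derivatives, Sobolev spaces and weighted Sobolev spaces on the real line -/

/-- `v` is the `k`-th weak derivative of `g` on `ℝ`. -/
def IsWeakDeriv (k : ℕ) (g v : ℝ → ℂ) : Prop :=
  LocallyIntegrable v ∧
    ∀ φ : ℝ → ℝ, ContDiff ℝ ∞ φ → HasCompactSupport φ →
      ∫ x, iteratedDeriv k φ x • g x = (-1 : ℂ) ^ k * ∫ x, φ x • v x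

open Classical in
/-- A representative of the `k`-th weak derivative of `g` (unique up to a null set);
`0` if there is no weak derivative. -/
def weakDeriv (k : ℕ) (g : ℝ → ℂ) : ℝ → ℂ :=
  if H : ∃ v, IsWeakDeriv k g v then H.choose else 0

/-- `g ∈ Hⁿ(ℝ)`: `g` and its weak derivatives up to order `n` are in `L²(ℝ)`. -/
def MemSobolev (n : ℕ) (g : ℝ → ℂ) : Prop :=
  MemLp g 2 ∧ ∀ k ≤ n, ∃ v, MemLp v 2 ∧ IsWeakDeriv k g v

/-- The `Hⁿ(ℝ)` norm. -/
def sobolevNorm (n : ℕ) (g : ℝ → ℂ) : ℝ≥0∞ :=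
  (∑ k ∈ Finset.range (n + 1), eLpNorm (weakDeriv k g) 2 ^ 2) ^ (1 / 2 : ℝ)

/-- `g ∈ Σⁿ(ℝ)`: `g ∈ Hⁿ(ℝ)` and `⟨x⟩ⁿ g ∈ L²(ℝ)`. -/
def MemSigma (n : ℕ) (g : ℝ → ℂ) : Prop :=
  MemSobolev n g ∧ MemLp (fun x => japanese x ^ n • g x) 2

/-- The `Σⁿ(ℝ)` norm. -/
def sigmaNorm (n : ℕ) (g : ℝ → ℂ) : ℝ≥0∞ :=
  sobolevNorm n g + eLpNorm (fun x => japanese x ^ n • g x) 2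

/-- The harmonic oscillator `H g = -g'' + x² g`, the derivative being taken in the weak sense. -/
def harmonicOscillator (g : ℝ → ℂ) : ℝ → ℂ :=
  fun x => -weakDeriv 2 g x + (x : ℂ) ^ 2 * g x

/-! ### The grid `hℤ` -/

/-- The grid `hℤ`. -/
abbrev Grid (h : ℝ) : Type := AddSubgroup.zmultiples h

/-- The point `h` of the grid `hℤ`. -/
def step (h : ℝ) : Grid h := ⟨h, AddSubgroup.mem_zmultiples h⟩

/-- The norm of `ℓ²(hℤ)`, `‖u‖² = h ∑ |u(a)|²`, with value `∞` if `u ∉ ℓ²(hℤ)`. -/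
def ell2Norm (h : ℝ) (u : Grid h → ℂ) : ℝ≥0∞ :=
  (ENNReal.ofReal h * ∑' a : Grid h, ‖u a‖ₑ ^ 2) ^ (1 / 2 : ℝ)

open Classical in
/-- The continuous representative of a function defined almost everywhere
(`0` if there is none). -/
def contRep (f : ℝ → ℂ) : ℝ → ℂ :=
  if H : ∃ u : ℝ → ℂ, Continuous u ∧ f =ᵐ[volume] u then H.choose else 0

/-- The projection `π_h` onto the grid: evaluation of the continuous representative. -/
def gridProj (h : ℝ) (f : ℝ → ℂ) : Grid h → ℂ := fun a => contRep f a

/-- The discrete oscillator `H_h`; it vanishes outside `A_h = hℤ ∩ [-1/h, 1/h]`. -/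
def discreteOscillator (h : ℝ) (u : Grid h → ℂ) : Grid h → ℂ := fun a =>
  if |(a : ℝ)| ≤ 1 / h then
    -(1 / h ^ 2 * √((1 + a * h + h ^ 2) * (1 - a * h)) : ℝ) * u (a + step h)
      - (1 / h ^ 2 * √((1 - a * h + h ^ 2) * (1 + a * h)) : ℝ) * u (a - step h)
      + (1 + 2 / h ^ 2 : ℝ) * u a
  else 0

/-! ### Kravchuk and Hermite functions -/

/-- The scaled Kravchuk polynomials
`k_{n+1,h}(x) = 2x k_{n,h}(x) - 2n (1 - h² (n-1)/2) k_{n-1,h}(x)`, `k_{0,h} = 1`. -/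
def kravchukPoly (h : ℝ) : ℕ → ℝ → ℝ
  | 0, _ => 1
  | 1, x => 2 * x
  | n + 2, x => 2 * x * kravchukPoly h (n + 1) x
      - 2 * (n + 1) * (1 - h ^ 2 * (n / 2)) * kravchukPoly h n x

/-- The rescaled binomial weight `ρ_h`; it vanishes outside `A_h`. -/
def rho (h : ℝ) (a : Grid h) : ℝ :=
  if |(a : ℝ)| ≤ 1 / h then
    1 / (h * 2 ^ (2 / h ^ 2)) *
      (Real.Gamma (1 + 2 / h ^ 2) /
        (Real.Gamma (1 + 1 / h ^ 2 + a / h) * Real.Gamma (1 + 1 / h ^ 2 - a / h)))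
  else 0

/-- The normalization constants `α_{n,h}`. -/
def alpha (n : ℕ) (h : ℝ) : ℝ :=
  1 / (h ^ n * √(n.factorial)) *
    √(Real.Gamma (1 + 2 / h ^ 2 - n) / Real.Gamma (1 + 2 / h ^ 2))

/-- The Kravchuk functions `φ_{n,h}`. -/
def kravchukFun (n : ℕ) (h : ℝ) (a : Grid h) : ℝ :=
  alpha n h * kravchukPoly h n a * √(rho h a)

/-- The (physicists') Hermite polynomials `H_{n+1}(x) = 2x H_n(x) - 2n H_{n-1}(x)`, `H_0 = 1`. -/
def hermitePoly : ℕ → ℝ → ℝ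
  | 0, _ => 1
  | 1, x => 2 * x
  | n + 2, x => 2 * x * hermitePoly (n + 1) x - 2 * (n + 1) * hermitePoly n x

/-- The Hermite functions `ψ_n`. -/
def hermiteFun (n : ℕ) (x : ℝ) : ℝ :=
  1 / (Real.pi ^ (1 / 4 : ℝ) * 2 ^ (n / 2 : ℝ) * √(n.factorial)) *
    Real.exp (-x ^ 2 / 2) * hermitePoly n x

/-- The step size `h = √2 N^{-1/2}`. -/
def mesh (N : ℕ) : ℝ := √2 * (N : ℝ) ^ (-(1 / 2) : ℝ)

end Kravchuk

end

/-! Part (i). Taylor expansion of `g (a ± h)` and of the coefficients of `H_h` bounds the error at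
`a` by `h²` times the size of the terms `⟨a⟩ ^ (4 - k) g^(k)`, `k ≤ 4`, on `[a - h, a + h]`. A local
Sobolev inequality on these overlapping cells costs one derivative or one power of `⟨a⟩` and bounds
the `ℓ²` norm of the error by the norms of `⟨x⟩ ^ (5 - k) g^(k)` in `L²(ℝ)`; integration by parts
interpolates the latter between `k = 0` and `k = 5`.

Part (ii). With `N = 2 M` and `a = k h`, the ratio `ρ_h(a) / ρ_h(0)` is a product of factors
`(1 - j / M) / (1 + j / M) ≈ exp (-2 j / M)`, hence close to `exp (-a²)`, and Wallis' product gives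
`ρ_h(0)`. The recurrence of the normalized Kravchuk polynomials perturbs that of the Hermite
polynomials by relative errors `O(h² n)`. Both families are dominated, up to the factor `2 ^ n`, by
`∏ (1 + |x| √(2 / (j + 1))) ≤ 4 ^ n exp (x² / 4)`, so that the difference of the functions is
`O(h² 16 ^ n exp (-x² / 4))` up to polynomial factors, and `16 ^ n ≤ h ^ (-δ)` for
`n ≤ δ |log h| / 3`. -/

namespace Kravchuk

/-! ### Sums over the grid -/

/-- The parametrization `k ↦ k h` of the grid `hℤ` by the integers. -/
noncomputable def gridEquiv {h : ℝ} (hh : 0 < h) : ℤ ≃ Grid h :=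
  Equiv.ofBijective (fun k => ⟨k * h, AddSubgroup.mem_zmultiples_iff.2 ⟨k, by simp⟩⟩) <| by
    constructor
    · intro k l hkl
      have : (k : ℝ) * h = l * h := congrArg Subtype.val hkl
      exact_mod_cast mul_right_cancel₀ hh.ne' this
    · rintro ⟨a, ha⟩
      obtain ⟨k, hk⟩ := AddSubgroup.mem_zmultiples_iff.1 ha
      exact ⟨k, Subtype.ext (by simpa using hk)⟩

@[simp] lemma coe_gridEquiv {h : ℝ} (hh : 0 < h) (k : ℤ) : (gridEquiv hh k : ℝ) = k * h := rfl

lemma ell2Norm_le_of_tsum_le_sq {h : ℝ} (hh : 0 < h) {u : Grid h → ℂ} {B : ℝ≥0∞}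
    (hB : ∑' k : ℤ, ENNReal.ofReal (h * ‖u (gridEquiv hh k)‖ ^ 2) ≤ B ^ 2) :
    ell2Norm h u ≤ B := by
  have hsum : ENNReal.ofReal h * ∑' a : Grid h, ‖u a‖ₑ ^ 2
      = ∑' k : ℤ, ENNReal.ofReal (h * ‖u (gridEquiv hh k)‖ ^ 2) := by
    rw [← (gridEquiv hh).tsum_eq, ← ENNReal.tsum_mul_left]
    simp only [ENNReal.ofReal_mul hh.le, ENNReal.ofReal_pow (norm_nonneg _), ofReal_norm]
  calc ell2Norm h u ≤ (B ^ 2) ^ (1 / 2 : ℝ) :=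
        ENNReal.rpow_le_rpow (hsum.trans_le hB) (by norm_num)
    _ = B := by
      rw [← ENNReal.rpow_natCast, ← ENNReal.rpow_mul]
      norm_num

lemma tsum_lintegral_Ioc_mul_add {h : ℝ} (hh : 0 < h) (F : ℝ → ℝ≥0∞) :
    ∑' k : ℤ, ∫⁻ x in Set.Ioc (k * h) (k * h + h), F x = ∫⁻ x, F x := by
  have hcover : ⋃ k : ℤ, Set.Ioc (k * h) (k * h + h) = Set.univ := by
    simpa [add_mul] using iUnion_Ioc_zsmul hh
  rw [← setLIntegral_univ, ← hcover, lintegral_iUnion (fun k => measurableSet_Ioc)]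
  simpa [Pairwise, Function.onFun, add_mul] using Set.pairwise_disjoint_Ioc_zsmul h

lemma tsum_lintegral_Ioc_mul_sub_add {h : ℝ} (hh : 0 < h) (F : ℝ → ℝ≥0∞) :
    ∑' k : ℤ, ∫⁻ x in Set.Ioc (k * h - h) (k * h + h), F x = 2 * ∫⁻ x, F x := by
  have hsplit : ∀ k : ℤ, ∫⁻ x in Set.Ioc (k * h - h) (k * h + h), F x
      = (∫⁻ x in Set.Ioc (((k - 1 : ℤ) : ℝ) * h) (((k - 1 : ℤ) : ℝ) * h + h), F x)
        + ∫⁻ x in Set.Ioc (k * h) (k * h + h), F x := by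
    intro k
    rw [← Set.Ioc_union_Ioc_eq_Ioc (b := k * h) (by linarith) (by linarith),
      lintegral_union measurableSet_Ioc (Set.Ioc_disjoint_Ioc_of_le le_rfl)]
    rw [show ((k - 1 : ℤ) : ℝ) * h = k * h - h by push_cast; ring, sub_add_cancel]
  have hshift := (Equiv.subRight (1 : ℤ)).tsum_eq
    (fun k : ℤ => ∫⁻ x in Set.Ioc ((k : ℝ) * h) (k * h + h), F x)
  simp only [Equiv.subRight_apply] at hshift
  simp_rw [hsplit]
  rw [ENNReal.tsum_add, hshift, tsum_lintegral_Ioc_mul_add hh, two_mul]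

lemma tsum_ofReal_le_of_le_integral {h : ℝ} (hh : 0 < h) {S : ℤ → ℝ} {Φ : ℝ → ℝ}
    (hΦ : LocallyIntegrable Φ) (hΦ0 : ∀ x, 0 ≤ Φ x) {C : ℝ} (hC : 0 ≤ C)
    (hS : ∀ k : ℤ, S k ≤ C * ∫ t in (k * h - h)..(k * h + h), Φ t) :
    ∑' k : ℤ, ENNReal.ofReal (S k)
      ≤ ENNReal.ofReal (2 * C) * ∫⁻ x, ENNReal.ofReal (Φ x) := by
  calc ∑' k : ℤ, ENNReal.ofReal (S k)
      ≤ ∑' k : ℤ, ENNReal.ofReal C *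
          ∫⁻ x in Set.Ioc (k * h - h) (k * h + h), ENNReal.ofReal (Φ x) := by
        refine ENNReal.tsum_le_tsum fun k => (ENNReal.ofReal_le_ofReal (hS k)).trans ?_
        rw [ENNReal.ofReal_mul hC, intervalIntegral.integral_of_le (by linarith),
          ofReal_integral_eq_lintegral_ofReal _ (ae_of_all _ hΦ0)]
        exact (hΦ.integrableOn_isCompact isCompact_Icc).mono_set Set.Ioc_subset_Icc_self
    _ = ENNReal.ofReal (2 * C) * ∫⁻ x, ENNReal.ofReal (Φ x) := by
        rw [ENNReal.tsum_mul_left, tsum_lintegral_Ioc_mul_sub_add hh, ← mul_assoc,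
          ENNReal.ofReal_mul zero_le_two, mul_comm (ENNReal.ofReal 2), ENNReal.ofReal_ofNat]

section Sobolev

variable {f f' : ℝ → ℝ} {c d x y : ℝ}

lemma sq_sub_sq_le_integral_sq_add_sq (hf : ∀ t, HasDerivAt f (f' t) t) (hf' : Continuous f')
    (hx : x ∈ Set.Icc c d) (hy : y ∈ Set.Icc c d) :
    f x ^ 2 - f y ^ 2 ≤ ∫ t in c..d, (f t ^ 2 + f' t ^ 2) := by
  have hfc : Continuous f := continuous_iff_continuousAt.2 fun t => (hf t).continuousAt
  have hcd : c ≤ d := hx.1.trans hx.2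
  have hsub : Set.uIoc y x ⊆ Set.Ioc c d :=
    Set.Ioc_subset_Ioc (le_min hy.1 hx.1) (max_le hy.2 hx.2)
  have hfint : IntegrableOn (fun t => f t ^ 2 + f' t ^ 2) (Set.Ioc c d) :=
    ((by fun_prop : Continuous fun t => f t ^ 2 + f' t ^ 2).intervalIntegrable c d).1
  have hFTC : ∫ t in y..x, 2 * f t * f' t = f x ^ 2 - f y ^ 2 :=
    intervalIntegral.integral_eq_sub_of_hasDerivAt (fun t _ => by simpa using (hf t).fun_pow 2)
      ((by fun_prop : Continuous fun t => 2 * f t * f' t).intervalIntegrable _ _)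
  calc f x ^ 2 - f y ^ 2 ≤ ‖∫ t in y..x, 2 * f t * f' t‖ := by rw [hFTC]; exact le_abs_self _
    _ ≤ ∫ t in Set.uIoc y x, ‖2 * f t * f' t‖ :=
        intervalIntegral.norm_integral_le_integral_norm_uIoc
    _ ≤ ∫ t in Set.uIoc y x, (f t ^ 2 + f' t ^ 2) := by
        refine integral_mono_of_nonneg (ae_of_all _ fun t => norm_nonneg _)
          (hfint.mono_set hsub) (ae_of_all _ fun t => ?_)
        exact abs_le.2 ⟨by linarith [sq_nonneg (f t + f' t)], two_mul_le_add_sq (f t) (f' t)⟩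
    _ ≤ ∫ t in Set.Ioc c d, (f t ^ 2 + f' t ^ 2) :=
        setIntegral_mono_set hfint (ae_of_all _ fun t => by positivity) (ae_of_all _ hsub)
    _ = ∫ t in c..d, (f t ^ 2 + f' t ^ 2) := (intervalIntegral.integral_of_le hcd).symm

-- Averages `f x ^ 2 ≤ f y ^ 2 + ∫ (f ^ 2 + f' ^ 2)` over `y ∈ [c, d]`.
lemma sub_mul_sq_le_integral_sq_add_sq (hf : ∀ t, HasDerivAt f (f' t) t) (hf' : Continuous f')
    (hx : x ∈ Set.Icc c d) :
    (d - c) * f x ^ 2 ≤ (1 + (d - c)) * ∫ t in c..d, (f t ^ 2 + f' t ^ 2) := by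
  have hfc : Continuous f := continuous_iff_continuousAt.2 fun t => (hf t).continuousAt
  have hcd : c ≤ d := hx.1.trans hx.2
  have hsq : IntervalIntegrable (fun t => f t ^ 2) volume c d :=
    (by fun_prop : Continuous fun t => f t ^ 2).intervalIntegrable _ _
  have havg : ∫ _ in c..d, (f x ^ 2 - ∫ t in c..d, (f t ^ 2 + f' t ^ 2)) ≤ ∫ y in c..d, f y ^ 2 :=
    intervalIntegral.integral_mono_on hcd (by simp) hsq fun y hy => by
      linarith [sq_sub_sq_le_integral_sq_add_sq hf hf' hx hy]
  have hmono : ∫ y in c..d, f y ^ 2 ≤ ∫ t in c..d, (f t ^ 2 + f' t ^ 2) :=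
    intervalIntegral.integral_mono_on hcd hsq
      ((by fun_prop : Continuous fun t => f t ^ 2 + f' t ^ 2).intervalIntegrable _ _)
      fun y _ => by linarith [sq_nonneg (f' y)]
  rw [intervalIntegral.integral_const, smul_eq_mul] at havg
  linarith

end Sobolev

/-! ### The binomial weight -/

/-- The ratio of a binomial coefficient to the central one in the same row; it is the shape of the
weight `ρ_h`, and it vanishes for `k > M`. -/
noncomputable def binomRatio (M k : ℕ) : ℝ := ((2 * M).choose (M + k) : ℝ) / M.centralBinom

lemma binomRatio_zero (M : ℕ) : binomRatio M 0 = 1 :=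
  div_self (by exact_mod_cast M.centralBinom_ne_zero)

lemma binomRatio_nonneg (M k : ℕ) : 0 ≤ binomRatio M k := by
  unfold binomRatio
  positivity

lemma binomRatio_eq_zero {M k : ℕ} (hk : M < k) : binomRatio M k = 0 := by
  simp [binomRatio, Nat.choose_eq_zero_of_lt (show 2 * M < M + k by omega)]

lemma binomRatio_succ {M k : ℕ} (hk : k ≤ M) :
    binomRatio M (k + 1) = binomRatio M k * (((M : ℝ) - k) / (M + k + 1)) := by
  have hrec := Nat.choose_succ_right_eq (2 * M) (M + k)
  rw [show 2 * M - (M + k) = M - k by omega] at hrec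
  have hrec' : ((2 * M).choose (M + k + 1) : ℝ) * (M + k + 1)
      = (2 * M).choose (M + k) * (M - k) := by
    have := congrArg (Nat.cast : ℕ → ℝ) hrec
    push_cast [hk] at this
    exact this
  rw [binomRatio, binomRatio, ← add_assoc,
    eq_div_of_mul_eq (show (M : ℝ) + k + 1 ≠ 0 by positivity) hrec']
  ring

-- The factor `1 + k / M` symmetrizes the recursion.
lemma binomRatio_succ_mul_one_add_div {M k : ℕ} (hM : 0 < M) (hk : k ≤ M) :
    binomRatio M (k + 1) * (1 + (k + 1 : ℕ) / M)
      = binomRatio M k * (1 + k / M) * ((1 - k / M) / (1 + k / M)) := by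
  have : (0 : ℝ) < M := by exact_mod_cast hM
  rw [binomRatio_succ hk]
  push_cast
  field_simp
  ring

lemma one_sub_div_one_add_le_exp {x : ℝ} (hx0 : 0 ≤ x) :
    (1 - x) / (1 + x) ≤ Real.exp (-(2 * x)) := by
  rcases le_or_gt 1 x with hx1 | hx1
  · exact (div_nonpos_of_nonpos_of_nonneg (by linarith) (by linarith)).trans (Real.exp_pos _).le
  have hlog : 2 * x ≤ Real.log (1 + x) - Real.log (1 - x) := by
    have hs := Real.hasSum_log_sub_log_of_abs_lt_one (x := x) (by rwa [abs_of_nonneg hx0])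
    have := hs.summable.sum_le_tsum (Finset.range 1) (fun i _ => by positivity)
    rw [hs.tsum_eq] at this
    simpa using this
  rw [← Real.log_le_iff_le_exp (div_pos (by linarith) (by linarith)),
    Real.log_div (by linarith) (by linarith)]
  linarith

lemma exp_neg_le_one_sub_div_one_add {x : ℝ} (hx0 : 0 ≤ x) (hx1 : x ≤ 1 / 2) :
    Real.exp (-(2 * x + 4 * x ^ 3)) ≤ (1 - x) / (1 + x) := by
  have hmul : 1 + x ≤ (1 - x) * Real.exp (2 * x + 4 * x ^ 3) := by
    have hexp := Real.quadratic_le_exp_of_nonneg (x := 2 * x + 4 * x ^ 3) (by positivity)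
    refine le_trans ?_ (mul_le_mul_of_nonneg_left hexp (by linarith))
    have h3 : 0 ≤ x ^ 3 * (1 / 2 - x) := mul_nonneg (by positivity) (by linarith)
    have h4 : 0 ≤ x ^ 4 * (1 / 2 - x) := mul_nonneg (by positivity) (by linarith)
    have h6 : 0 ≤ x ^ 6 * (1 / 2 - x) := mul_nonneg (by positivity) (by linarith)
    nlinarith [pow_nonneg hx0 3, pow_nonneg hx0 5]
  rw [Real.exp_neg, inv_le_comm₀ (Real.exp_pos _) (div_pos (by linarith) (by linarith)), inv_div,
    div_le_iff₀ (by linarith), mul_comm]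
  exact hmul

lemma binomRatio_mul_one_add_div_le {M : ℕ} (hM : 0 < M) (k : ℕ) :
    binomRatio M k * (1 + k / M) ≤ Real.exp (-(k * (k - 1) / M)) := by
  induction k with
  | zero => simp [binomRatio_zero]
  | succ k ih =>
    rcases lt_or_ge M (k + 1) with hk | hk
    · simp [binomRatio_eq_zero hk, Real.exp_nonneg]
    have hkM : (k : ℝ) / M ≤ 1 := div_le_one_of_le₀ (by exact_mod_cast (by omega)) (by positivity)
    rw [binomRatio_succ_mul_one_add_div hM (by omega)]
    calc binomRatio M k * (1 + k / M) * ((1 - k / M) / (1 + k / M))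
        ≤ Real.exp (-(k * (k - 1) / M)) * Real.exp (-(2 * (k / M))) :=
          mul_le_mul ih (one_sub_div_one_add_le_exp (by positivity))
            (div_nonneg (by linarith) (by positivity)) (Real.exp_pos _).le
      _ = Real.exp (-((k + 1 : ℕ) * ((k + 1 : ℕ) - 1) / M)) := by
          rw [← Real.exp_add]
          congr 1
          push_cast
          ring

lemma exp_neg_le_binomRatio_mul_one_add_div {M k : ℕ} (hM : 0 < M) (hk : 2 * k ≤ M) :
    Real.exp (-(k * (k - 1) / M + k ^ 4 / M ^ 3)) ≤ binomRatio M k * (1 + k / M) := by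
  have hM' : (0 : ℝ) < M := by exact_mod_cast hM
  induction k with
  | zero => simp [binomRatio_zero]
  | succ k ih =>
    have ih := ih (by omega)
    have hkM : (k : ℝ) / M ≤ 1 / 2 := by
      rw [div_le_iff₀ hM']
      have : 2 * ((k : ℝ) + 1) ≤ M := by exact_mod_cast hk
      linarith
    have hpow : (k : ℝ) ^ 4 / M ^ 3 + 4 * (k / M) ^ 3 ≤ ((k + 1 : ℕ) : ℝ) ^ 4 / M ^ 3 := by
      rw [div_pow, mul_div_assoc', ← add_div]
      gcongr
      push_cast
      nlinarith [sq_nonneg (k : ℝ), k.cast_nonneg (α := ℝ)]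
    rw [binomRatio_succ_mul_one_add_div hM (by omega)]
    calc Real.exp (-((k + 1 : ℕ) * ((k + 1 : ℕ) - 1) / M + (k + 1 : ℕ) ^ 4 / M ^ 3))
        ≤ Real.exp (-(k * (k - 1) / M + k ^ 4 / M ^ 3 + (2 * (k / M) + 4 * (k / M) ^ 3))) := by
          have hlin : ((k + 1 : ℕ) : ℝ) * ((k + 1 : ℕ) - 1) / M
              = k * (k - 1) / M + 2 * (k / M) := by
            push_cast
            ring
          rw [Real.exp_le_exp]
          linarith
      _ = Real.exp (-(k * (k - 1) / M + k ^ 4 / M ^ 3))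
            * Real.exp (-(2 * (k / M) + 4 * (k / M) ^ 3)) := by rw [neg_add, Real.exp_add]
      _ ≤ binomRatio M k * (1 + k / M) * ((1 - k / M) / (1 + k / M)) :=
          mul_le_mul ih (exp_neg_le_one_sub_div_one_add (by positivity) hkM) (Real.exp_pos _).le
            ((Real.exp_pos _).le.trans ih)

lemma binomRatio_mul_exp_le {M : ℕ} (hM : 0 < M) (k : ℕ) :
    binomRatio M k * Real.exp (k ^ 2 / M) ≤ 1 + (k / M) ^ 2 := by
  have hM' : (0 : ℝ) < M := by exact_mod_cast hM
  rcases lt_or_ge M k with hk | hk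
  · rw [binomRatio_eq_zero hk, zero_mul]
    positivity
  set y : ℝ := k / M with hy
  have hy0 : 0 ≤ y := by positivity
  have hy1 : y ≤ 1 := div_le_one_of_le₀ (by exact_mod_cast hk) hM'.le
  have hexp : Real.exp y ≤ 1 + y + y ^ 2 := by
    linarith [(abs_le.1 (Real.abs_exp_sub_one_sub_id_le (by rwa [abs_of_nonneg hy0]))).2]
  refine le_of_mul_le_mul_right ?_ (by linarith : 0 < 1 + y)
  calc binomRatio M k * Real.exp (k ^ 2 / M) * (1 + y)
      = binomRatio M k * (1 + y) * Real.exp (k ^ 2 / M) := by ring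
    _ ≤ Real.exp (-(k * (k - 1) / M)) * Real.exp (k ^ 2 / M) :=
        mul_le_mul_of_nonneg_right (binomRatio_mul_one_add_div_le hM k) (Real.exp_pos _).le
    _ = Real.exp y := by
        rw [← Real.exp_add, hy]
        congr 1
        ring
    _ ≤ (1 + y ^ 2) * (1 + y) := by nlinarith [pow_nonneg hy0 3]

lemma one_sub_le_binomRatio_mul_exp {M k : ℕ} (hM : 0 < M) (hk : 2 * k ≤ M) :
    1 - k ^ 4 / M ^ 3 ≤ binomRatio M k * Real.exp (k ^ 2 / M) := by
  set y : ℝ := k / M with hy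
  have hy0 : 0 ≤ y := by positivity
  have hmul : Real.exp (-((k : ℝ) ^ 4 / M ^ 3)) ≤ binomRatio M k * Real.exp (k ^ 2 / M) := by
    refine le_of_mul_le_mul_right ?_ (by linarith : 0 < 1 + y)
    calc Real.exp (-((k : ℝ) ^ 4 / M ^ 3)) * (1 + y)
        ≤ Real.exp (-((k : ℝ) ^ 4 / M ^ 3)) * Real.exp y := by
          gcongr
          linarith [Real.add_one_le_exp y]
      _ = Real.exp (-(k * (k - 1) / M + k ^ 4 / M ^ 3)) * Real.exp (k ^ 2 / M) := by
          rw [← Real.exp_add, ← Real.exp_add, hy]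
          congr 1
          ring
      _ ≤ binomRatio M k * (1 + y) * Real.exp (k ^ 2 / M) :=
          mul_le_mul_of_nonneg_right (exp_neg_le_binomRatio_mul_one_add_div hM hk)
            (Real.exp_pos _).le
      _ = binomRatio M k * Real.exp (k ^ 2 / M) * (1 + y) := by ring
  linarith [Real.add_one_le_exp (-((k : ℝ) ^ 4 / M ^ 3))]

lemma abs_binomRatio_mul_exp_sub_one_le {M : ℕ} (hM : 0 < M) (k : ℕ) :
    |binomRatio M k * Real.exp (k ^ 2 / M) - 1| ≤ k ^ 4 / M ^ 3 + 4 * (k / M) ^ 2 := by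
  have h4 : 0 ≤ (k : ℝ) ^ 4 / M ^ 3 := by positivity
  have h2 : 0 ≤ ((k : ℝ) / M) ^ 2 := by positivity
  refine abs_le.2 ⟨?_, by linarith [binomRatio_mul_exp_le hM k]⟩
  by_cases hk : 2 * k ≤ M
  · linarith [one_sub_le_binomRatio_mul_exp hM hk]
  · have hkM : 1 / 2 ≤ (k : ℝ) / M := by
      rw [div_le_div_iff₀ two_pos (by exact_mod_cast hM)]
      exact_mod_cast (by omega)
    have := mul_nonneg (binomRatio_nonneg M k) (Real.exp_pos ((k : ℝ) ^ 2 / M)).le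
    nlinarith

/-- The central binomial coefficient divided by its asymptotic value `4 ^ M / √(π M)`. -/
noncomputable def centralRatio (M : ℕ) : ℝ := √(Real.pi * M) * (M.centralBinom / 4 ^ M)

lemma centralRatio_nonneg (M : ℕ) : 0 ≤ centralRatio M := by
  unfold centralRatio
  positivity

lemma centralRatio_sq (M : ℕ) :
    centralRatio M ^ 2 = Real.pi * M / ((2 * M + 1) * Real.Wallis.W M) := by
  have hfac : (M.centralBinom : ℝ) = (2 * M).factorial / (M.factorial : ℝ) ^ 2 := by
    rw [Nat.centralBinom, Nat.cast_choose ℝ (by omega), show 2 * M - M = M by omega, sq]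
  have hM : (M.factorial : ℝ) ≠ 0 := by positivity
  have h2M : ((2 * M).factorial : ℝ) ≠ 0 := by positivity
  rw [Real.Wallis.W_eq_factorial_ratio, centralRatio, mul_pow, hfac,
    Real.sq_sqrt (by positivity), show (4 : ℝ) ^ M = 2 ^ (2 * M) by rw [pow_mul]; norm_num,
    show 4 * M = 2 * M + 2 * M by ring, pow_add]
  field_simp

lemma centralRatio_sq_le_one (M : ℕ) : centralRatio M ^ 2 ≤ 1 := by
  have hW := Real.Wallis.W_pos M
  rw [centralRatio_sq, div_le_one (by positivity)]
  calc Real.pi * M ≤ Real.pi * ((2 * M + 1) * ((2 * M + 1) / (2 * M + 2)) / 2) := by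
        gcongr
        rw [mul_div_assoc', div_div, le_div_iff₀ (by positivity)]
        linarith
    _ = (2 * M + 1) * ((2 * M + 1) / (2 * M + 2) * (Real.pi / 2)) := by ring
    _ ≤ (2 * M + 1) * Real.Wallis.W M := by gcongr; exact Real.Wallis.le_W M

lemma one_sub_one_div_le_centralRatio_sq {M : ℕ} (hM : 0 < M) :
    1 - 1 / (M : ℝ) ≤ centralRatio M ^ 2 := by
  have hW := Real.Wallis.W_pos M
  have hM1 : 1 / (M : ℝ) ≤ 1 := by
    rw [one_div]
    exact inv_le_one_of_one_le₀ (by exact_mod_cast hM)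
  have : (0 : ℝ) < M := by exact_mod_cast hM
  rw [centralRatio_sq, le_div_iff₀ (by positivity)]
  calc (1 - 1 / (M : ℝ)) * ((2 * M + 1) * Real.Wallis.W M)
      ≤ (1 - 1 / (M : ℝ)) * ((2 * M + 1) * (Real.pi / 2)) := by
        gcongr
        exact Real.Wallis.W_le M
    _ = Real.pi * M - Real.pi / 2 * (1 + 1 / M) := by field_simp; ring
    _ ≤ Real.pi * M := sub_le_self _ (by positivity)

lemma abs_centralRatio_sub_one_le {M : ℕ} (hM : 0 < M) :
    |centralRatio M - 1| ≤ 1 / M := by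
  have hle : centralRatio M ≤ 1 := (sq_le_one_iff₀ (centralRatio_nonneg M)).1
    (centralRatio_sq_le_one M)
  rw [abs_sub_comm, abs_of_nonneg (by linarith)]
  nlinarith [one_sub_one_div_le_centralRatio_sq hM, centralRatio_nonneg M]

section Weight

variable {M : ℕ} {h : ℝ}

lemma rho_neg (a : Grid h) : rho h (-a) = rho h a := by
  simp only [rho, NegMemClass.coe_neg, abs_neg, neg_div, sub_neg_eq_add, ← sub_eq_add_neg]
  rw [mul_comm (Real.Gamma _)]

lemma abs_mul_le_one_div_iff (hh : 0 < h) (hM : h ^ 2 * M = 1) (k : ℕ) :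
    |k * h| ≤ 1 / h ↔ k ≤ M := by
  rw [abs_of_nonneg (by positivity), le_div_iff₀ hh, ← hM, mul_comm (h ^ 2), mul_assoc, ← sq,
    mul_le_mul_iff_left₀ (by positivity), Nat.cast_le]

lemma rho_eq_choose (hh : 0 < h) (hM : h ^ 2 * M = 1) {a : Grid h} {k : ℕ}
    (ha : (a : ℝ) = k * h) : rho h a = (2 * M).choose (M + k) / (h * 4 ^ M) := by
  have hinv : 1 / h ^ 2 = M := by rw [← hM]; field_simp
  have hinv2 : 2 / h ^ 2 = ((2 * M : ℕ) : ℝ) := by push_cast; rw [← hinv]; ring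
  have hak : (a : ℝ) / h = k := by rw [ha]; field_simp
  have hpow : (2 : ℝ) ^ (2 * M) = 4 ^ M := by rw [pow_mul]; norm_num
  simp only [rho, ha ▸ abs_mul_le_one_div_iff hh hM k, hinv, hinv2, hak, Real.rpow_natCast, hpow]
  split_ifs with hk
  · have hΓ (n : ℕ) : Real.Gamma (1 + n) = n.factorial := by
      rw [add_comm, Real.Gamma_nat_eq_factorial]
    rw [show (1 + M + k : ℝ) = 1 + (M + k : ℕ) by push_cast; ring,
      show (1 + M - k : ℝ) = 1 + (M - k : ℕ) by push_cast [hk]; ring, hΓ, hΓ, hΓ,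
      Nat.cast_choose ℝ (by omega), show 2 * M - (M + k) = M - k by omega]
    ring
  · rw [Nat.choose_eq_zero_of_lt (by omega), Nat.cast_zero, zero_div]

lemma rho_nonneg (hh : 0 < h) (hM : h ^ 2 * M = 1) (a : Grid h) : 0 ≤ rho h a := by
  obtain ⟨z, rfl⟩ := (gridEquiv hh).surjective a
  wlog hz : 0 ≤ z generalizing z
  · rw [← rho_neg]
    convert this (-z) (by omega)
    exact Subtype.ext (by simp)
  obtain ⟨k, rfl⟩ := Int.eq_ofNat_of_zero_le hz
  rw [rho_eq_choose hh hM (k := k) (by simp)]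
  positivity

lemma sqrt_pi_mul_rho_eq (hh : 0 < h) (hM : h ^ 2 * M = 1) {a : Grid h} {k : ℕ}
    (ha : (a : ℝ) = k * h) : √Real.pi * rho h a = centralRatio M * binomRatio M k := by
  have hsqrt : √(M : ℝ) = 1 / h := by
    rw [Real.sqrt_eq_iff_eq_sq (by positivity) (by positivity), div_pow, one_pow,
      eq_div_iff (by positivity), mul_comm, hM]
  have hcb : (M.centralBinom : ℝ) ≠ 0 := by exact_mod_cast M.centralBinom_ne_zero
  rw [rho_eq_choose hh hM ha, centralRatio, binomRatio, Real.sqrt_mul Real.pi_pos.le, hsqrt]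
  field_simp

lemma abs_sqrt_pi_mul_rho_mul_exp_sub_one_le_of_eq (hh : 0 < h) (hM : h ^ 2 * M = 1) {a : Grid h}
    {k : ℕ} (ha : (a : ℝ) = k * h) :
    |√Real.pi * rho h a * Real.exp ((a : ℝ) ^ 2) - 1| ≤ 2 * h ^ 2 * (1 + (a : ℝ) ^ 2) ^ 2 := by
  have hM0 : 0 < M := Nat.pos_of_ne_zero (by rintro rfl; simp at hM)
  have hMh : (M : ℝ) = 1 / h ^ 2 := by rw [← hM]; field_simp
  have hX := abs_binomRatio_mul_exp_sub_one_le hM0 k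
  rw [show (k : ℝ) ^ 4 / M ^ 3 = h ^ 2 * (a : ℝ) ^ 4 by rw [ha, hMh]; field_simp,
    show ((k : ℝ) / M) ^ 2 = h ^ 2 * (a : ℝ) ^ 2 by rw [ha, hMh]; field_simp,
    show (k : ℝ) ^ 2 / M = (a : ℝ) ^ 2 by rw [ha, hMh]; field_simp] at hX
  have hY := abs_centralRatio_sub_one_le hM0
  rw [hMh, one_div_one_div] at hY
  have hY1 : |centralRatio M| ≤ 1 := (sq_le_one_iff_abs_le_one _).1 (centralRatio_sq_le_one M)
  rw [sqrt_pi_mul_rho_eq hh hM ha]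
  set X := binomRatio M k * Real.exp ((a : ℝ) ^ 2) with hXdef
  calc |centralRatio M * binomRatio M k * Real.exp ((a : ℝ) ^ 2) - 1|
      = |centralRatio M * (X - 1) + (centralRatio M - 1)| := by rw [hXdef]; ring_nf
    _ ≤ |centralRatio M| * |X - 1| + |centralRatio M - 1| :=
        (abs_add_le _ _).trans_eq (by rw [abs_mul])
    _ ≤ 1 * (h ^ 2 * (a : ℝ) ^ 4 + 4 * (h ^ 2 * (a : ℝ) ^ 2)) + h ^ 2 := by gcongr
    _ ≤ 2 * h ^ 2 * (1 + (a : ℝ) ^ 2) ^ 2 := by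
        nlinarith [sq_nonneg h, sq_nonneg (h * (a : ℝ) ^ 2)]

lemma abs_sqrt_pi_mul_rho_mul_exp_sub_one_le (hh : 0 < h) (hM : h ^ 2 * M = 1) (a : Grid h) :
    |√Real.pi * rho h a * Real.exp ((a : ℝ) ^ 2) - 1| ≤ 2 * h ^ 2 * (1 + (a : ℝ) ^ 2) ^ 2 := by
  obtain ⟨z, rfl⟩ := (gridEquiv hh).surjective a
  obtain ⟨k, rfl | rfl⟩ := z.eq_nat_or_neg
  · exact abs_sqrt_pi_mul_rho_mul_exp_sub_one_le_of_eq hh hM (k := k) (by simp)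
  · have := abs_sqrt_pi_mul_rho_mul_exp_sub_one_le_of_eq hh hM (a := -gridEquiv hh (-(k : ℤ)))
      (k := k) (by simp)
    rwa [rho_neg, NegMemClass.coe_neg, neg_sq] at this

end Weight

/-! ### Three-term recurrences -/

section Recurrence

variable {b m r : ℕ → ℝ} {L n : ℕ}

lemma abs_le_pow_mul_of_recurrence {C : ℝ} (hC : 1 ≤ C) (hb : ∀ n, 0 ≤ b n) (hm0 : ∀ n, 0 ≤ m n)
    (hm : ∀ n, b n * m (n + 1) + m n ≤ m (n + 2)) (h0 : |r 0| ≤ m 0) (h1 : |r 1| ≤ m 1)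
    (hr : ∀ n, n + 2 ≤ L → |r (n + 2)| ≤ C * (b n * |r (n + 1)| + |r n|)) (hn : n ≤ L) :
    |r n| ≤ C ^ n * m n := by
  induction n using Nat.strong_induction_on with
  | _ n ih =>
  match n, hn, ih with
  | 0, _, _ => simpa using h0
  | 1, _, _ => simpa using h1.trans (le_mul_of_one_le_left (hm0 1) hC)
  | n + 2, hn, ih =>
    have hpow : C ^ n ≤ C ^ (n + 1) := pow_le_pow_right₀ hC n.le_succ
    calc |r (n + 2)| ≤ C * (b n * |r (n + 1)| + |r n|) := hr n hn
      _ ≤ C * (b n * (C ^ (n + 1) * m (n + 1)) + C ^ (n + 1) * m n) := by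
          gcongr
          · exact hb n
          · exact ih (n + 1) (by omega) (by omega)
          · exact (ih n (by omega) (by omega)).trans (mul_le_mul_of_nonneg_right hpow (hm0 n))
      _ = C ^ (n + 2) * (b n * m (n + 1) + m n) := by ring
      _ ≤ C ^ (n + 2) * m (n + 2) := by gcongr; exact hm n

lemma abs_le_mul_mul_two_pow_mul_of_recurrence {κ : ℝ} (hκ : 0 ≤ κ) (hb : ∀ n, 0 ≤ b n)
    (hm0 : ∀ n, 0 ≤ m n) (hm : ∀ n, b n * m (n + 1) + m n ≤ m (n + 2)) (h0 : r 0 = 0) (h1 : r 1 = 0)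
    (hr : ∀ n, n + 2 ≤ L →
      |r (n + 2)| ≤ b n * |r (n + 1)| + |r n| + κ * (n + 1) * (2 ^ (n + 1) * m (n + 2)))
    (hn : n ≤ L) : |r n| ≤ κ * n * 2 ^ n * m n := by
  induction n using Nat.strong_induction_on with
  | _ n ih =>
  match n, hn, ih with
  | 0, _, _ => simp [h0]
  | 1, _, _ =>
    rw [h1, abs_zero]
    exact mul_nonneg (by positivity) (hm0 1)
  | n + 2, hn, ih =>
    have hcoeff : κ * n * 2 ^ n ≤ κ * (n + 1 : ℕ) * 2 ^ (n + 1) := by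
      gcongr <;> first | omega | norm_num
    calc |r (n + 2)|
        ≤ b n * |r (n + 1)| + |r n| + κ * (n + 1) * (2 ^ (n + 1) * m (n + 2)) := hr n hn
      _ ≤ b n * (κ * (n + 1 : ℕ) * 2 ^ (n + 1) * m (n + 1)) + κ * (n + 1 : ℕ) * 2 ^ (n + 1) * m n
            + κ * (n + 1) * (2 ^ (n + 1) * m (n + 2)) := by
          gcongr
          · exact hb n
          · exact ih (n + 1) (by omega) (by omega)
          · exact (ih n (by omega) (by omega)).trans (mul_le_mul_of_nonneg_right hcoeff (hm0 n))
      _ = κ * (n + 1) * 2 ^ (n + 1) * (b n * m (n + 1) + m n)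
            + κ * (n + 1) * (2 ^ (n + 1) * m (n + 2)) := by push_cast; ring
      _ ≤ κ * (n + 1) * 2 ^ (n + 1) * m (n + 2) + κ * (n + 1) * (2 ^ (n + 1) * m (n + 2)) := by
          gcongr
          exact hm n
      _ = κ * (n + 1) * 2 ^ (n + 2) * m (n + 2) := by ring
      _ ≤ κ * (n + 2 : ℕ) * 2 ^ (n + 2) * m (n + 2) := by
          have := hm0 (n + 2)
          push_cast
          gcongr
          norm_num

lemma abs_perturbation_sub_le {β ζ ε ε' κ p q p' q' : ℝ} (hζ0 : 0 ≤ ζ) (hζ1 : ζ ≤ 1)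
    (hε : |ε| ≤ κ) (hε' : |ε'| ≤ κ) :
    |(1 + ε) * (β * p) - (1 + ε') * (ζ * p') - (β * q - ζ * q')|
      ≤ |β| * |p - q| + |p' - q'| + κ * (|β| * |p| + |p'|) := by
  calc |(1 + ε) * (β * p) - (1 + ε') * (ζ * p') - (β * q - ζ * q')|
      = |β * (p - q) - ζ * (p' - q') + (ε * (β * p) - ε' * (ζ * p'))| := by ring_nf
    _ ≤ |β * (p - q)| + |ζ * (p' - q')| + (|ε * (β * p)| + |ε' * (ζ * p')|) :=
        (abs_add_le _ _).trans (add_le_add (abs_sub _ _) (abs_sub _ _))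
    _ = |β| * |p - q| + ζ * |p' - q'| + (|ε| * (|β| * |p|) + |ε'| * (ζ * |p'|)) := by
        simp only [abs_mul, abs_of_nonneg hζ0]
    _ ≤ |β| * |p - q| + 1 * |p' - q'| + (κ * (|β| * |p|) + κ * (1 * |p'|)) := by
        have hκ : 0 ≤ κ := (abs_nonneg ε).trans hε
        gcongr
    _ = |β| * |p - q| + |p' - q'| + κ * (|β| * |p| + |p'|) := by ring

end Recurrence

/-- The majorant `∏_{j < n} (1 + s √(2 / (j + 1)))` of the solutions of the Hermite recurrence at
`±s`. -/
noncomputable def majorant (s : ℝ) (n : ℕ) : ℝ :=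
  ∏ j ∈ Finset.range n, (1 + √(2 / (j + 1)) * s)

section Majorant

variable {s : ℝ}

lemma majorant_succ (s : ℝ) (n : ℕ) :
    majorant s (n + 1) = majorant s n * (1 + √(2 / (n + 1)) * s) :=
  Finset.prod_range_succ _ _

lemma majorant_nonneg (hs : 0 ≤ s) (n : ℕ) : 0 ≤ majorant s n :=
  Finset.prod_nonneg fun _ _ => by positivity

lemma mul_majorant_succ_add_le (hs : 0 ≤ s) (n : ℕ) :
    √(2 / (n + 2)) * s * majorant s (n + 1) + majorant s n ≤ majorant s (n + 2) := by
  have hmono : majorant s n ≤ majorant s (n + 1) := by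
    rw [majorant_succ]
    exact le_mul_of_one_le_right (majorant_nonneg hs n) (le_add_of_nonneg_right (by positivity))
  rw [majorant_succ s (n + 1)]
  push_cast
  rw [add_assoc, one_add_one_eq_two]
  linarith

lemma prod_one_add_div_le_two_pow_mul_exp {z : ℝ} (hz : 0 ≤ z) (n : ℕ) :
    ∏ j ∈ Finset.range n, (1 + z / ((j : ℝ) + 1)) ≤ 2 ^ n * Real.exp z := by
  induction n with
  | zero => simpa using hz
  | succ n ih =>
    rcases le_or_gt z (n + 1) with hzn | hzn
    · have hfactor : 1 + z / ((n : ℝ) + 1) ≤ 2 := by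
        linarith [(div_le_one (by positivity)).2 hzn]
      calc ∏ j ∈ Finset.range (n + 1), (1 + z / ((j : ℝ) + 1))
          ≤ 2 ^ n * Real.exp z * 2 := by
            rw [Finset.prod_range_succ]
            exact mul_le_mul ih hfactor (by positivity) (by positivity)
        _ = 2 ^ (n + 1) * Real.exp z := by ring
    · calc ∏ j ∈ Finset.range (n + 1), (1 + z / ((j : ℝ) + 1))
          ≤ ∏ j ∈ Finset.range (n + 1), (2 * z / ((j : ℝ) + 1)) := by
            refine Finset.prod_le_prod (fun j _ => by positivity) fun j hj => ?_
            have hj' : (j : ℝ) ≤ n := by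
              exact_mod_cast Nat.lt_succ_iff.1 (Finset.mem_range.1 hj)
            have : 1 ≤ z / ((j : ℝ) + 1) := by rw [one_le_div (by positivity)]; linarith
            rw [mul_div_assoc]
            linarith
        _ = 2 ^ (n + 1) * (z ^ (n + 1) / (n + 1).factorial) := by
            rw [Finset.prod_div_distrib, Finset.prod_const, Finset.card_range, mul_pow,
              ← Finset.prod_range_add_one_eq_factorial, mul_div_assoc]
            push_cast
            rfl
        _ ≤ 2 ^ (n + 1) * Real.exp z := by
            gcongr
            exact Real.pow_div_factorial_le_exp _ hz _

lemma majorant_le (hs : 0 ≤ s) (n : ℕ) : majorant s n ≤ 4 ^ n * Real.exp (s ^ 2 / 4) := by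
  refine le_of_sq_le_sq ?_ (by positivity)
  calc majorant s n ^ 2
      ≤ ∏ j ∈ Finset.range n, (5 * (1 + s ^ 2 / 2 / ((j : ℝ) + 1))) := by
        rw [majorant, ← Finset.prod_pow]
        refine Finset.prod_le_prod (fun j _ => by positivity) fun j _ => ?_
        have hsq : (√(2 / ((j : ℝ) + 1)) * s) ^ 2 = 4 * (s ^ 2 / 2 / (j + 1)) := by
          rw [mul_pow, Real.sq_sqrt (by positivity)]
          field_simp
          ring
        nlinarith [sq_nonneg (√(2 / ((j : ℝ) + 1)) * s / 2 - 2)]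
    _ ≤ 5 ^ n * (2 ^ n * Real.exp (s ^ 2 / 2)) := by
        rw [Finset.prod_mul_distrib, Finset.prod_const, Finset.card_range]
        gcongr
        exact prod_one_add_div_le_two_pow_mul_exp (by positivity) n
    _ = 10 ^ n * Real.exp (s ^ 2 / 2) := by rw [← mul_assoc, ← mul_pow]; norm_num
    _ ≤ 16 ^ n * Real.exp (s ^ 2 / 2) := by gcongr; norm_num
    _ = (4 ^ n * Real.exp (s ^ 2 / 4)) ^ 2 := by
        rw [mul_pow, ← pow_mul, mul_comm n, pow_mul, ← Real.exp_nat_mul]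
        congr 2
        · norm_num
        · push_cast
          ring

end Majorant

/-! ### Normalized Hermite and Kravchuk polynomials -/

/-- The `L²`-normalization constant of the Hermite polynomials for the weight `exp (-x²) / √π`. -/
noncomputable def hermiteNorm (n : ℕ) : ℝ := 1 / (2 ^ (n / 2 : ℝ) * √(n.factorial))

/-- The Hermite polynomials orthonormal for the weight `exp (-x²) / √π`. -/
noncomputable def normalizedHermite (n : ℕ) (x : ℝ) : ℝ := hermiteNorm n * hermitePoly n x

/-- The Kravchuk polynomials orthonormal for the weight `ρ_h`. -/
noncomputable def normalizedKravchuk (h : ℝ) (n : ℕ) (x : ℝ) : ℝ := alpha n h * kravchukPoly h n x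

lemma hermiteNorm_succ (n : ℕ) : hermiteNorm (n + 1) = hermiteNorm n / √(2 * (n + 1)) := by
  unfold hermiteNorm
  rw [Nat.factorial_succ, show (((n + 1 : ℕ) : ℝ) / 2) = n / 2 + 1 / 2 by push_cast; ring,
    Real.rpow_add (by norm_num), ← Real.sqrt_eq_rpow]
  push_cast
  rw [Real.sqrt_mul (by positivity), Real.sqrt_mul (by norm_num)]
  field_simp

lemma alpha_succ {h : ℝ} (hh : 0 < h) {n : ℕ} (hn : h ^ 2 * n < 2) :
    alpha (n + 1) h = alpha n h / (√(2 * (n + 1)) * √(1 - h ^ 2 * (n / 2))) := by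
  have hpos : 0 < 2 / h ^ 2 - n := by
    rw [sub_pos, lt_div_iff₀ (by positivity)]
    linarith
  have hΓ : Real.Gamma (1 + 2 / h ^ 2 - n)
      = (2 / h ^ 2 - n) * Real.Gamma (1 + 2 / h ^ 2 - (n + 1 : ℕ)) := by
    rw [show (1 + 2 / h ^ 2 - ((n + 1 : ℕ) : ℝ)) = 2 / h ^ 2 - n by push_cast; ring,
      ← Real.Gamma_add_one hpos.ne']
    ring_nf
  have hsqrt : √(2 / h ^ 2 - n) = √2 * √(1 - h ^ 2 * (n / 2)) / h := by
    rw [← Real.sqrt_mul zero_le_two, eq_div_iff hh.ne']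
    nth_rewrite 2 [← Real.sqrt_sq hh.le]
    rw [← Real.sqrt_mul hpos.le]
    congr 1
    field_simp
  have hc : 0 < √(1 - h ^ 2 * (n / 2)) := Real.sqrt_pos.2 (by linarith)
  rw [alpha, alpha, hΓ, mul_div_assoc (2 / h ^ 2 - (n : ℝ)), Real.sqrt_mul hpos.le, hsqrt,
    Nat.factorial_succ]
  push_cast
  rw [Real.sqrt_mul (by positivity), Real.sqrt_mul zero_le_two]
  generalize √(1 - h ^ 2 * ((n : ℝ) / 2)) = c at hc ⊢
  rw [pow_succ]
  field_simp

lemma two_div_sqrt_two_mul (t : ℝ) : 2 / √(2 * t) = √(2 / t) := by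
  rw [Real.sqrt_mul zero_le_two, Real.sqrt_div zero_le_two, ← div_div, Real.div_sqrt]

lemma two_mul_div_sqrt_mul_sqrt {s t : ℝ} (hs : 0 < s) :
    2 * s / (√(2 * s) * √(2 * t)) = √(s / t) := by
  rw [← div_div, Real.div_sqrt, ← Real.sqrt_div (by positivity), mul_div_mul_left _ _ two_ne_zero]

lemma normalizedHermite_add_two (n : ℕ) (x : ℝ) :
    normalizedHermite (n + 2) x = √(2 / (n + 2)) * x * normalizedHermite (n + 1) x
      - √((n + 1) / (n + 2)) * normalizedHermite n x := by
  have h1 := hermiteNorm_succ (n + 1)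
  push_cast at h1
  rw [add_assoc (n : ℝ), one_add_one_eq_two] at h1
  simp only [normalizedHermite, hermitePoly, ← two_div_sqrt_two_mul ((n : ℝ) + 2),
    ← two_mul_div_sqrt_mul_sqrt (s := (n : ℝ) + 1) (t := n + 2) (by positivity), h1,
    hermiteNorm_succ n]
  ring

lemma normalizedKravchuk_add_two {h : ℝ} (hh : 0 < h) {n : ℕ} (hn : h ^ 2 * (n + 1) < 2) (x : ℝ) :
    normalizedKravchuk h (n + 2) x
      = 1 / √(1 - h ^ 2 * ((n + 1) / 2)) * (√(2 / (n + 2)) * x * normalizedKravchuk h (n + 1) x)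
        - √(1 - h ^ 2 * (n / 2)) / √(1 - h ^ 2 * ((n + 1) / 2)) *
          (√((n + 1) / (n + 2)) * normalizedKravchuk h n x) := by
  have hn0 : h ^ 2 * n < 2 := by nlinarith [sq_nonneg h]
  have h1 := alpha_succ hh (n := n + 1) (by push_cast; exact hn)
  push_cast at h1
  rw [add_assoc (n : ℝ), one_add_one_eq_two] at h1
  have hc0 : 1 - h ^ 2 * ((n : ℝ) / 2) = √(1 - h ^ 2 * (n / 2)) * √(1 - h ^ 2 * (n / 2)) :=
    (Real.mul_self_sqrt (by linarith)).symm
  have hpos : √(1 - h ^ 2 * ((n : ℝ) / 2)) ≠ 0 := (Real.sqrt_pos.2 (by linarith)).ne'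
  simp only [normalizedKravchuk, kravchukPoly, ← two_div_sqrt_two_mul ((n : ℝ) + 2),
    ← two_mul_div_sqrt_mul_sqrt (s := (n : ℝ) + 1) (t := n + 2) (by positivity), h1,
    alpha_succ hh hn0]
  generalize √(1 - h ^ 2 * ((n : ℝ) / 2)) = c at *
  rw [hc0]
  field_simp

lemma normalizedHermite_zero (x : ℝ) : normalizedHermite 0 x = 1 := by
  simp [normalizedHermite, hermiteNorm, hermitePoly]

lemma normalizedHermite_one (x : ℝ) : normalizedHermite 1 x = √2 * x := by
  have h0 : hermiteNorm 0 = 1 := by simp [hermiteNorm]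
  rw [normalizedHermite, hermitePoly, hermiteNorm_succ, h0, Nat.cast_zero, zero_add, mul_one,
    ← mul_assoc, one_div_mul_eq_div, Real.div_sqrt]

lemma normalizedKravchuk_zero {h : ℝ} (x : ℝ) : normalizedKravchuk h 0 x = 1 := by
  have : Real.Gamma (1 + 2 / h ^ 2) ≠ 0 := (Real.Gamma_pos_of_pos (by positivity)).ne'
  simp [normalizedKravchuk, alpha, kravchukPoly, this]

lemma normalizedKravchuk_one {h : ℝ} (hh : 0 < h) (x : ℝ) : normalizedKravchuk h 1 x = √2 * x := by
  have hα0 : alpha 0 h = 1 := by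
    simpa [normalizedKravchuk, kravchukPoly] using normalizedKravchuk_zero (h := h) x
  rw [normalizedKravchuk, kravchukPoly, alpha_succ hh (n := 0) (by norm_num), hα0, Nat.cast_zero,
    zero_add, zero_div, mul_zero, sub_zero, Real.sqrt_one, mul_one, mul_one, ← mul_assoc,
    one_div_mul_eq_div, Real.div_sqrt]

lemma one_div_sqrt_one_sub_le {t : ℝ} (ht0 : 0 ≤ t) (ht : t ≤ 1 / 2) :
    1 / √(1 - t) ≤ 1 + 2 * t := by
  rw [div_le_iff₀ (Real.sqrt_pos.2 (by linarith)), ← div_le_iff₀' (by positivity)]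
  refine Real.le_sqrt_of_sq_le ?_
  rw [div_pow, one_pow, div_le_iff₀ (by positivity)]
  nlinarith [mul_nonneg ht0 (sub_nonneg.2 ht), mul_nonneg (mul_nonneg ht0 ht0) (sub_nonneg.2 ht)]

lemma exists_normalizedKravchuk_add_two_eq {h : ℝ} (hh : 0 < h) {n : ℕ} (hn : h ^ 2 * (n + 1) ≤ 1)
    (x : ℝ) : ∃ ε ε' : ℝ, |ε| ≤ h ^ 2 * (n + 1) ∧ |ε'| ≤ h ^ 2 * (n + 1) ∧
      normalizedKravchuk h (n + 2) x
        = (1 + ε) * (√(2 / (n + 2)) * x * normalizedKravchuk h (n + 1) x)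
          - (1 + ε') * (√((n + 1) / (n + 2)) * normalizedKravchuk h n x) := by
  set A := √(1 - h ^ 2 * ((n + 1) / 2))
  set B := √(1 - h ^ 2 * ((n : ℝ) / 2))
  have hA0 : 0 < A := Real.sqrt_pos.2 (by linarith)
  have hAB : A ≤ B := Real.sqrt_le_sqrt (by linarith [sq_nonneg h])
  have hB1 : B ≤ 1 := Real.sqrt_le_one.2 (sub_le_self _ (by positivity))
  have hup : 1 / A ≤ 1 + h ^ 2 * (n + 1) :=
    (one_div_sqrt_one_sub_le (by positivity) (by linarith)).trans_eq (by ring)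
  have hBA : 1 ≤ B / A := (one_le_div hA0).2 hAB
  have hBA' : B / A ≤ 1 / A := by gcongr
  refine ⟨1 / A - 1, B / A - 1, abs_le.2 ⟨?_, by linarith⟩, abs_le.2 ⟨?_, by linarith⟩, ?_⟩
  · linarith
  · linarith
  · rw [normalizedKravchuk_add_two hh (by linarith), add_sub_cancel, add_sub_cancel]

lemma sqrt_succ_div_add_two_le_one (n : ℕ) : √(((n : ℝ) + 1) / (n + 2)) ≤ 1 :=
  Real.sqrt_le_one.2 ((div_le_one (by positivity)).2 (by linarith))

lemma abs_normalizedHermite_le (n : ℕ) (x : ℝ) : |normalizedHermite n x| ≤ majorant |x| n := by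
  have := abs_le_pow_mul_of_recurrence (r := (normalizedHermite · x)) (L := n) le_rfl
    (b := fun k => √(2 / (k + 2)) * |x|) (fun k => by positivity) (majorant_nonneg (abs_nonneg x))
    (mul_majorant_succ_add_le (abs_nonneg x)) (by simp [normalizedHermite_zero, majorant])
    (by simp [normalizedHermite_one, majorant, abs_mul, abs_of_nonneg]) (fun k _ => ?_) le_rfl
  · simpa using this
  · rw [normalizedHermite_add_two, one_mul]
    refine (abs_sub _ _).trans ?_
    rw [abs_mul, abs_mul, abs_mul, abs_of_nonneg (Real.sqrt_nonneg _),
      abs_of_nonneg (Real.sqrt_nonneg _)]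
    gcongr
    exact mul_le_of_le_one_left (abs_nonneg _) (sqrt_succ_div_add_two_le_one k)

section KravchukBounds

variable {h : ℝ} {n : ℕ}

lemma sq_mul_succ_le_one_of_le {k : ℕ} (hn : h ^ 2 * n ≤ 1) (hk : k + 2 ≤ n) :
    h ^ 2 * ((k : ℝ) + 1) ≤ 1 :=
  (mul_le_mul_of_nonneg_left (by exact_mod_cast (by omega : k + 1 ≤ n)) (sq_nonneg h)).trans hn

lemma abs_normalizedKravchuk_le (hh : 0 < h) (hn : h ^ 2 * n ≤ 1) (x : ℝ) :
    |normalizedKravchuk h n x| ≤ 2 ^ n * majorant |x| n := by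
  refine abs_le_pow_mul_of_recurrence (r := (normalizedKravchuk h · x)) (L := n) one_le_two
    (b := fun k => √(2 / (k + 2)) * |x|) (fun k => by positivity) (majorant_nonneg (abs_nonneg x))
    (mul_majorant_succ_add_le (abs_nonneg x)) (by simp [normalizedKravchuk_zero, majorant])
    (by simp [normalizedKravchuk_one hh, majorant, abs_mul, abs_of_nonneg]) (fun k hk => ?_) le_rfl
  have hk1 := sq_mul_succ_le_one_of_le hn hk
  obtain ⟨ε, ε', hε, hε', hrec⟩ := exists_normalizedKravchuk_add_two_eq hh hk1 x
  have hε2 : |1 + ε| ≤ 2 := (abs_add_le _ _).trans (by rw [abs_one]; linarith)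
  have hε'2 : |1 + ε'| ≤ 2 := (abs_add_le _ _).trans (by rw [abs_one]; linarith)
  rw [hrec]
  refine (abs_sub _ _).trans ?_
  simp only [abs_mul, abs_of_nonneg (Real.sqrt_nonneg _)]
  rw [mul_add]
  gcongr
  exact mul_le_of_le_one_left (abs_nonneg _) (sqrt_succ_div_add_two_le_one k)

lemma abs_normalizedKravchuk_sub_normalizedHermite_le (hh : 0 < h) (hn : h ^ 2 * n ≤ 1) (x : ℝ) :
    |normalizedKravchuk h n x - normalizedHermite n x| ≤ h ^ 2 * n * 2 ^ n * majorant |x| n := by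
  refine abs_le_mul_mul_two_pow_mul_of_recurrence (L := n)
    (r := fun k => normalizedKravchuk h k x - normalizedHermite k x) (sq_nonneg h)
    (b := fun k => √(2 / (k + 2)) * |x|) (fun k => by positivity) (majorant_nonneg (abs_nonneg x))
    (mul_majorant_succ_add_le (abs_nonneg x))
    (by simp [normalizedKravchuk_zero, normalizedHermite_zero])
    (by simp [normalizedKravchuk_one hh, normalizedHermite_one]) (fun k hk => ?_) le_rfl
  obtain ⟨ε, ε', hε, hε', hrec⟩ :=
    exists_normalizedKravchuk_add_two_eq hh (sq_mul_succ_le_one_of_le hn hk) x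
  have hp (j : ℕ) (hj : j ≤ n) : |normalizedKravchuk h j x| ≤ 2 ^ j * majorant |x| j :=
    abs_normalizedKravchuk_le hh
      ((mul_le_mul_of_nonneg_left (by exact_mod_cast hj) (sq_nonneg h)).trans hn) x
  have hp0 : |normalizedKravchuk h k x| ≤ 2 ^ (k + 1) * majorant |x| k :=
    (hp k (by omega)).trans (by
      have := majorant_nonneg (abs_nonneg x) k
      gcongr <;> norm_num)
  have hstep := abs_perturbation_sub_le (β := √(2 / ((k : ℝ) + 2)) * x)
    (p := normalizedKravchuk h (k + 1) x) (q := normalizedHermite (k + 1) x)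
    (p' := normalizedKravchuk h k x) (q' := normalizedHermite k x)
    (Real.sqrt_nonneg _) (sqrt_succ_div_add_two_le_one k) hε hε'
  rw [← hrec, ← normalizedHermite_add_two, abs_mul, abs_of_nonneg (Real.sqrt_nonneg _)] at hstep
  refine hstep.trans ?_
  gcongr
  calc √(2 / ((k : ℝ) + 2)) * |x| * |normalizedKravchuk h (k + 1) x| + |normalizedKravchuk h k x|
      ≤ √(2 / ((k : ℝ) + 2)) * |x| * (2 ^ (k + 1) * majorant |x| (k + 1))
          + 2 ^ (k + 1) * majorant |x| k := by
        gcongr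
        exact hp (k + 1) (by omega)
    _ = 2 ^ (k + 1) * (√(2 / ((k : ℝ) + 2)) * |x| * majorant |x| (k + 1) + majorant |x| k) := by
        ring
    _ ≤ 2 ^ (k + 1) * majorant |x| (k + 2) := by
        gcongr
        exact mul_majorant_succ_add_le (abs_nonneg x) k

end KravchukBounds

/-! ### Gaussian bounds on the grid -/

lemma one_le_japanese (x : ℝ) : 1 ≤ japanese x := by
  rw [japanese, Real.one_le_sqrt]
  linarith [sq_nonneg x]

lemma japanese_sq (x : ℝ) : japanese x ^ 2 = 1 + x ^ 2 := Real.sq_sqrt (by positivity)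

lemma exists_japanese_rpow_mul_exp_le (σ : ℝ) :
    ∃ C : ℝ, 0 < C ∧ ∀ x : ℝ,
      japanese x ^ σ * ((1 + x ^ 2) ^ 2 * Real.exp (-x ^ 2 / 4)) ≤ C * (1 + x ^ 2)⁻¹ := by
  obtain ⟨n, hn⟩ := exists_nat_ge σ
  refine ⟨(n + 3).factorial * 4 ^ (n + 3) * Real.exp (1 / 4), by positivity, fun x => ?_⟩
  have hpow : japanese x ^ σ ≤ (1 + x ^ 2) ^ n := calc
    japanese x ^ σ ≤ japanese x ^ ((2 * n : ℕ) : ℝ) := by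
        refine Real.rpow_le_rpow_of_exponent_le (one_le_japanese x) (hn.trans ?_)
        exact_mod_cast Nat.le_mul_of_pos_left n two_pos
    _ = (1 + x ^ 2) ^ n := by rw [Real.rpow_natCast, pow_mul, japanese_sq]
  have hexp : (1 + x ^ 2) ^ (n + 3)
      ≤ (n + 3).factorial * 4 ^ (n + 3) * Real.exp (1 / 4) * Real.exp (x ^ 2 / 4) := by
    have := Real.pow_div_factorial_le_exp ((1 + x ^ 2) / 4) (by positivity) (n + 3)
    rw [div_pow, div_div, div_le_iff₀ (by positivity), add_div, Real.exp_add] at this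
    linarith
  rw [← div_eq_mul_inv, le_div_iff₀ (by positivity), neg_div, Real.exp_neg]
  calc japanese x ^ σ * ((1 + x ^ 2) ^ 2 * (Real.exp (x ^ 2 / 4))⁻¹) * (1 + x ^ 2)
      ≤ (1 + x ^ 2) ^ n * ((1 + x ^ 2) ^ 2 * (Real.exp (x ^ 2 / 4))⁻¹) * (1 + x ^ 2) := by gcongr
    _ = (1 + x ^ 2) ^ (n + 3) / Real.exp (x ^ 2 / 4) := by ring
    _ ≤ (n + 3).factorial * 4 ^ (n + 3) * Real.exp (1 / 4) := (div_le_iff₀ (Real.exp_pos _)).2 hexp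

lemma mul_inv_one_add_sq_le_integral {h : ℝ} (hh : 0 ≤ h) (h1 : h ≤ 1) (x : ℝ) :
    h * (1 + x ^ 2)⁻¹ ≤ 3 / 2 * ∫ t in (x - h)..(x + h), (1 + t ^ 2)⁻¹ := by
  have hpoint (t : ℝ) (ht : t ∈ Set.Icc (x - h) (x + h)) :
      (1 + x ^ 2)⁻¹ / 3 ≤ (1 + t ^ 2)⁻¹ := by
    rw [← one_div, div_div, inv_eq_one_div]
    refine one_div_le_one_div_of_le (by positivity) ?_
    nlinarith [sq_nonneg (t - 2 * x), abs_le_one_iff_mul_self_le_one.1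
      (abs_le.2 ⟨by linarith [ht.1], by linarith [ht.2]⟩ : |t - x| ≤ 1)]
  have hcont : Continuous fun t : ℝ => (1 + t ^ 2)⁻¹ :=
    (by fun_prop : Continuous fun t : ℝ => 1 + t ^ 2).inv₀ fun t => by positivity
  have := intervalIntegral.integral_mono_on (μ := volume) (by linarith) intervalIntegrable_const
    (hcont.intervalIntegrable (x - h) (x + h)) hpoint
  rw [intervalIntegral.integral_const, smul_eq_mul] at this
  linarith

lemma exists_ell2Norm_le_of_gaussian (σ : ℝ) :
    ∃ C : ℝ, 0 < C ∧ ∀ h : ℝ, 0 < h → h ≤ 1 → ∀ D : ℝ, 0 ≤ D → ∀ u : Grid h → ℂ,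
      (∀ a : Grid h, ‖u a‖ ≤ japanese a ^ σ *
        (D * ((1 + (a : ℝ) ^ 2) ^ 2 * Real.exp (-(a : ℝ) ^ 2 / 4)))) →
      ell2Norm h u ≤ ENNReal.ofReal (C * D) := by
  obtain ⟨C, hC, hb⟩ := exists_japanese_rpow_mul_exp_le σ
  refine ⟨√(3 * Real.pi) * C, by positivity, fun h hh h1 D hD u hu => ?_⟩
  refine ell2Norm_le_of_tsum_le_sq hh ?_
  have hcell (k : ℤ) : h * ‖u (gridEquiv hh k)‖ ^ 2
      ≤ (C * D) ^ 2 * (3 / 2) * ∫ t in (k * h - h)..(k * h + h), (1 + t ^ 2)⁻¹ := by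
    set y := (1 + (k * h : ℝ) ^ 2)⁻¹
    have hu' : ‖u (gridEquiv hh k)‖ ≤ C * D * y := by
      have := mul_le_mul_of_nonneg_left (hb (k * h)) hD
      have := hu (gridEquiv hh k)
      rw [coe_gridEquiv] at this
      linarith
    have hy : y ^ 2 ≤ y := by
      refine pow_le_of_le_one (by positivity) (inv_le_one_of_one_le₀ ?_) two_ne_zero
      linarith [sq_nonneg (k * h : ℝ)]
    calc h * ‖u (gridEquiv hh k)‖ ^ 2 ≤ h * (C * D * y) ^ 2 := by gcongr
      _ = (C * D) ^ 2 * (h * y ^ 2) := by ring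
      _ ≤ (C * D) ^ 2 * (h * y) := by gcongr
      _ ≤ (C * D) ^ 2 * (3 / 2 * ∫ t in (k * h - h)..(k * h + h), (1 + t ^ 2)⁻¹) :=
          mul_le_mul_of_nonneg_left (mul_inv_one_add_sq_le_integral hh.le h1 _) (sq_nonneg _)
      _ = _ := by ring
  refine (tsum_ofReal_le_of_le_integral hh integrable_inv_one_add_sq.locallyIntegrable
    (fun x => by positivity) (by positivity) hcell).trans_eq ?_
  rw [← ofReal_integral_eq_lintegral_ofReal integrable_inv_one_add_sq
    (ae_of_all _ fun x => by positivity), integral_univ_inv_one_add_sq,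
    ← ENNReal.ofReal_mul (by positivity), ← ENNReal.ofReal_pow (by positivity), mul_assoc _ C,
    mul_pow √_, Real.sq_sqrt (by positivity)]
  ring_nf

/-! ### Convergence of the Kravchuk functions -/

/-- The ground state `ψ_0` of the harmonic oscillator. -/
noncomputable def gaussian (x : ℝ) : ℝ := (Real.pi ^ (1 / 4 : ℝ))⁻¹ * Real.exp (-x ^ 2 / 2)

lemma gaussian_pos (x : ℝ) : 0 < gaussian x := by unfold gaussian; positivity

lemma gaussian_sq (x : ℝ) : gaussian x ^ 2 = 1 / √Real.pi * Real.exp (-x ^ 2) := by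
  rw [gaussian, mul_pow, inv_pow, ← Real.rpow_mul_natCast Real.pi_pos.le, ← Real.exp_nat_mul,
    Real.sqrt_eq_rpow, one_div]
  congr 2
  · norm_num
  · push_cast
    ring

lemma gaussian_le (x : ℝ) : gaussian x ≤ Real.exp (-x ^ 2 / 2) :=
  mul_le_of_le_one_left (Real.exp_pos _).le <| inv_le_one_of_one_le₀ <|
    Real.one_le_rpow (by linarith [Real.pi_gt_three]) (by norm_num)

lemma gaussian_sq_le (x : ℝ) : gaussian x ^ 2 ≤ Real.exp (-x ^ 2 / 4) := by
  refine (pow_le_pow_left₀ (gaussian_pos x).le (gaussian_le x) 2).trans ?_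
  rw [← Real.exp_nat_mul, Real.exp_le_exp]
  push_cast
  linarith [sq_nonneg x]

lemma hermiteFun_eq (n : ℕ) (x : ℝ) : hermiteFun n x = normalizedHermite n x * gaussian x := by
  unfold hermiteFun normalizedHermite hermiteNorm gaussian
  field_simp

lemma continuous_hermitePoly : ∀ n : ℕ, Continuous (hermitePoly n)
  | 0 => continuous_const (y := (1 : ℝ))
  | 1 => continuous_const_mul (2 : ℝ)
  | n + 2 => by
    have h0 := continuous_hermitePoly n
    have h1 := continuous_hermitePoly (n + 1)
    change Continuous fun x =>
      2 * x * hermitePoly (n + 1) x - 2 * ((n : ℝ) + 1) * hermitePoly n x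
    fun_prop

lemma contRep_eq {f u : ℝ → ℂ} (hu : Continuous u) (hfu : f =ᵐ[volume] u) : contRep f = u := by
  have H : ∃ u : ℝ → ℂ, Continuous u ∧ f =ᵐ[volume] u := ⟨u, hu, hfu⟩
  rw [contRep, dif_pos H]
  exact (H.choose_spec.1.ae_eq_iff_eq volume hu).1 (H.choose_spec.2.symm.trans hfu)

lemma gridProj_hermiteFun (h : ℝ) (n : ℕ) (a : Grid h) :
    gridProj h (fun x => (hermiteFun n x : ℂ)) a = hermiteFun n a := by
  have hc : Continuous fun x => (hermiteFun n x : ℂ) := by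
    have := continuous_hermitePoly n
    unfold hermiteFun
    fun_prop
  rw [gridProj, contRep_eq hc (ae_eq_refl _)]

section Comparison

variable {M : ℕ} {h : ℝ}

lemma le_one_of_sq_mul_natCast_eq_one (hh : 0 < h) (hM : h ^ 2 * M = 1) : h ≤ 1 := by
  have hM1 : (1 : ℝ) ≤ M := Nat.one_le_cast.2 (Nat.pos_of_ne_zero (by rintro rfl; simp at hM))
  refine (sq_le_one_iff₀ hh.le).1 ?_
  rw [← hM]
  exact le_mul_of_one_le_right (sq_nonneg h) hM1

lemma abs_rho_sub_le (hh : 0 < h) (hM : h ^ 2 * M = 1) (a : Grid h) :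
    |rho h a - gaussian a ^ 2| ≤ 2 * h ^ 2 * (1 + (a : ℝ) ^ 2) ^ 2 * gaussian a ^ 2 := by
  have hfactor : rho h a - gaussian a ^ 2
      = (√Real.pi * rho h a * Real.exp ((a : ℝ) ^ 2) - 1) * gaussian a ^ 2 := by
    rw [gaussian_sq, Real.exp_neg]
    field_simp
  rw [hfactor, abs_mul, abs_of_nonneg (sq_nonneg (gaussian a))]
  gcongr
  exact abs_sqrt_pi_mul_rho_mul_exp_sub_one_le hh hM a

lemma abs_sqrt_rho_sub_le (hh : 0 < h) (hM : h ^ 2 * M = 1) (a : Grid h) :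
    |√(rho h a) - gaussian a| ≤ 2 * h ^ 2 * (1 + (a : ℝ) ^ 2) ^ 2 * gaussian a := by
  have hg := gaussian_pos a
  refine le_of_mul_le_mul_right ?_ hg
  calc |√(rho h a) - gaussian a| * gaussian a
      ≤ |√(rho h a) - gaussian a| * (√(rho h a) + gaussian a) := by
        gcongr
        exact le_add_of_nonneg_left (Real.sqrt_nonneg _)
    _ = |rho h a - gaussian a ^ 2| := by
        nth_rewrite 3 [← Real.sq_sqrt (rho_nonneg hh hM a)]
        rw [sq_sub_sq, abs_mul, abs_of_nonneg (by positivity : 0 ≤ √(rho h a) + gaussian a),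
          mul_comm]
    _ ≤ 2 * h ^ 2 * (1 + (a : ℝ) ^ 2) ^ 2 * gaussian a ^ 2 := abs_rho_sub_le hh hM a
    _ = 2 * h ^ 2 * (1 + (a : ℝ) ^ 2) ^ 2 * gaussian a * gaussian a := by ring

lemma sqrt_rho_le (hh : 0 < h) (hM : h ^ 2 * M = 1) (a : Grid h) :
    √(rho h a) ≤ 3 * (1 + (a : ℝ) ^ 2) ^ 2 * gaussian a := by
  have hg := gaussian_pos a
  have hW : 1 ≤ (1 + (a : ℝ) ^ 2) ^ 2 := one_le_pow₀ (by linarith [sq_nonneg (a : ℝ)])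
  have hh2 : h ^ 2 ≤ 1 := pow_le_one₀ hh.le (le_one_of_sq_mul_natCast_eq_one hh hM)
  calc √(rho h a) ≤ 1 * gaussian a + 2 * h ^ 2 * (1 + (a : ℝ) ^ 2) ^ 2 * gaussian a := by
        linarith [(abs_le.1 (abs_sqrt_rho_sub_le hh hM a)).2]
    _ ≤ (1 + (a : ℝ) ^ 2) ^ 2 * gaussian a + 2 * 1 * (1 + (a : ℝ) ^ 2) ^ 2 * gaussian a := by
        gcongr
    _ = 3 * (1 + (a : ℝ) ^ 2) ^ 2 * gaussian a := by ring

lemma majorant_mul_gaussian_le (n : ℕ) (x : ℝ) :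
    majorant |x| n * gaussian x ≤ 4 ^ n * Real.exp (-x ^ 2 / 4) := by
  calc majorant |x| n * gaussian x
      ≤ 4 ^ n * Real.exp (|x| ^ 2 / 4) * Real.exp (-x ^ 2 / 2) := by
        gcongr
        · exact (gaussian_pos x).le
        · exact majorant_le (abs_nonneg x) n
        · exact gaussian_le x
    _ = 4 ^ n * Real.exp (-x ^ 2 / 4) := by
        rw [mul_assoc, ← Real.exp_add, sq_abs]
        ring_nf

lemma abs_kravchukFun_sub_le (hh : 0 < h) (hM : h ^ 2 * M = 1) {n : ℕ} (hn : h ^ 2 * n ≤ 1)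
    (a : Grid h) :
    |kravchukFun n h a - hermiteFun n a|
      ≤ 5 * h ^ 2 * 16 ^ n * ((1 + (a : ℝ) ^ 2) ^ 2 * Real.exp (-(a : ℝ) ^ 2 / 4)) := by
  have := gaussian_pos a
  have hm := majorant_nonneg (abs_nonneg (a : ℝ)) n
  set p := normalizedKravchuk h n a
  set q := normalizedHermite n a
  set m := majorant |(a : ℝ)| n
  set W := (1 + (a : ℝ) ^ 2) ^ 2
  have hn4 : (n : ℝ) * 2 ^ n ≤ 4 ^ n := by
    have hn2 : (n : ℝ) ≤ 2 ^ n := by exact_mod_cast Nat.lt_two_pow_self.le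
    calc (n : ℝ) * 2 ^ n ≤ 2 ^ n * 2 ^ n := by gcongr
      _ = 4 ^ n := by rw [← mul_pow]; norm_num
  have hpq : |p - q| ≤ h ^ 2 * 4 ^ n * m := by
    refine (abs_normalizedKravchuk_sub_normalizedHermite_le hh hn (a : ℝ)).trans ?_
    rw [mul_assoc (h ^ 2)]
    gcongr
  have hq : |q| ≤ 4 ^ n * m :=
    (abs_normalizedHermite_le n (a : ℝ)).trans <|
      le_mul_of_one_le_left hm (one_le_pow₀ (by norm_num))
  calc |kravchukFun n h a - hermiteFun n a|
      = |(p - q) * √(rho h a) + q * (√(rho h a) - gaussian a)| := by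
        rw [hermiteFun_eq, kravchukFun, ← normalizedKravchuk]
        congr 1
        ring
    _ ≤ |p - q| * √(rho h a) + |q| * |√(rho h a) - gaussian a| := by
        refine (abs_add_le _ _).trans_eq ?_
        rw [abs_mul, abs_mul q, abs_of_nonneg (Real.sqrt_nonneg _)]
    _ ≤ h ^ 2 * 4 ^ n * m * (3 * W * gaussian a) + 4 ^ n * m * (2 * h ^ 2 * W * gaussian a) := by
        gcongr
        · exact sqrt_rho_le hh hM a
        · exact abs_sqrt_rho_sub_le hh hM a
    _ = 5 * h ^ 2 * 4 ^ n * W * (m * gaussian a) := by ring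
    _ ≤ 5 * h ^ 2 * 4 ^ n * W * (4 ^ n * Real.exp (-(a : ℝ) ^ 2 / 4)) :=
        mul_le_mul_of_nonneg_left (majorant_mul_gaussian_le n a) (by positivity)
    _ = 5 * h ^ 2 * 16 ^ n * (W * Real.exp (-(a : ℝ) ^ 2 / 4)) := by
        rw [show (16 : ℝ) = 4 * 4 by norm_num, mul_pow]
        ring

end Comparison

theorem exists_ell2Norm_rho_sub_le_and_kravchukFun_sub_le (σ : ℝ) :
    ∃ C : ℝ, 0 < C ∧ ∀ (M : ℕ) (h : ℝ), 0 < h → h ^ 2 * M = 1 →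
      ell2Norm h (fun a => ((japanese a ^ σ *
          (rho h a - 1 / √Real.pi * Real.exp (-(a : ℝ) ^ 2)) : ℝ) : ℂ))
        ≤ ENNReal.ofReal (C * h ^ 2) ∧
      ∀ n : ℕ, h ^ 2 * n ≤ 1 →
        ell2Norm h (fun a => ((japanese a ^ σ : ℝ) : ℂ) *
            ((kravchukFun n h a : ℂ) - gridProj h (fun x => (hermiteFun n x : ℂ)) a))
          ≤ ENNReal.ofReal (C * (h ^ 2 * 16 ^ n)) := by
  obtain ⟨C, hC, hb⟩ := exists_ell2Norm_le_of_gaussian σ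
  refine ⟨C * 5, by positivity, fun M h hh hM => ?_⟩
  have h1 := le_one_of_sq_mul_natCast_eq_one hh hM
  have hj (a : Grid h) : 0 ≤ japanese a ^ σ :=
    Real.rpow_nonneg (zero_le_one.trans (one_le_japanese a)) σ
  simp only [gridProj_hermiteFun, ← Complex.ofReal_sub, ← Complex.ofReal_mul, ← gaussian_sq]
  refine ⟨?_, fun n hn => ?_⟩
  · rw [mul_assoc]
    refine hb h hh h1 _ (by positivity) _ fun a => ?_
    rw [Complex.norm_real, Real.norm_eq_abs, abs_mul, abs_of_nonneg (hj a)]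
    refine mul_le_mul_of_nonneg_left ((abs_rho_sub_le hh hM a).trans ?_) (hj a)
    rw [mul_assoc]
    gcongr
    · norm_num
    · exact gaussian_sq_le a
  · rw [mul_assoc, ← mul_assoc 5]
    refine hb h hh h1 _ (by positivity) _ fun a => ?_
    rw [Complex.norm_real, Real.norm_eq_abs, abs_mul, abs_of_nonneg (hj a)]
    exact mul_le_mul_of_nonneg_left (abs_kravchukFun_sub_le hh hM hn a) (hj a)

lemma sixteen_pow_le_rpow_neg {h δ : ℝ} (hh : 0 < h) (h1 : h ≤ 1) {n : ℕ}
    (hn : (n : ℝ) ≤ 1 / 3 * δ * |Real.log h|) : (16 : ℝ) ^ n ≤ h ^ (-δ) := by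
  rw [abs_of_nonpos (Real.log_nonpos hh.le h1)] at hn
  have hexp : (16 : ℝ) ≤ Real.exp 3 := by
    calc (16 : ℝ) ≤ 2.7 ^ 3 := by norm_num
      _ ≤ Real.exp 1 ^ 3 := by gcongr; linarith [Real.exp_one_gt_d9]
      _ = Real.exp 3 := by rw [← Real.exp_nat_mul]; norm_num
  calc (16 : ℝ) ^ n ≤ Real.exp 3 ^ n := by gcongr
    _ = Real.exp (n * 3) := by rw [← Real.exp_nat_mul]
    _ ≤ Real.exp (Real.log h * (-δ)) := by rw [Real.exp_le_exp]; linarith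
    _ = h ^ (-δ) := (Real.rpow_def_of_pos hh _).symm

lemma sq_mul_le_one_of_le_mul_abs_log {h δ t : ℝ} (hh : 0 < h) (h1 : h ≤ 1) (hδ : 0 ≤ δ)
    (hδh : δ * h ≤ 3) (ht : t ≤ 1 / 3 * δ * |Real.log h|) : h ^ 2 * t ≤ 1 := by
  have hlog : |Real.log h| ≤ h⁻¹ := by
    rw [abs_of_nonpos (Real.log_nonpos hh.le h1), ← Real.log_inv]
    exact Real.log_le_self (by positivity)
  calc h ^ 2 * t ≤ h ^ 2 * (1 / 3 * δ * h⁻¹) := by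
        gcongr
        exact ht.trans (by gcongr)
    _ = δ * h / 3 := by field_simp
    _ ≤ 1 := by linarith

lemma mesh_pos {N : ℕ} (hN : 0 < N) : 0 < mesh N := by
  unfold mesh
  positivity

lemma mesh_sq (N : ℕ) : mesh N ^ 2 = 2 / N := by
  rw [mesh, mul_pow, Real.sq_sqrt zero_le_two, ← Real.rpow_mul_natCast N.cast_nonneg,
    show -(1 / 2 : ℝ) * (2 : ℕ) = -1 by norm_num, Real.rpow_neg_one, div_eq_mul_inv]

lemma mesh_le_one {N : ℕ} (hN : 2 ≤ N) : mesh N ≤ 1 := by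
  refine (sq_le_one_iff₀ (mesh_pos (by lia)).le).1 ?_
  rw [mesh_sq]
  exact div_le_one_of_le₀ (Nat.ofNat_le_cast.2 hN) N.cast_nonneg

theorem kravchuk_convergence {δ : ℝ} (hδ : 0 < δ) (σ : ℝ) :
    ∃ (C : ℝ) (N₀ : ℕ), ∀ N : ℕ, N₀ ≤ N → Even N → ∀ h : ℝ, h = mesh N →
      ell2Norm h (fun a => ((japanese a ^ σ *
          (rho h a - 1 / √Real.pi * Real.exp (-(a : ℝ) ^ 2)) : ℝ) : ℂ))
        ≤ ENNReal.ofReal (C * h ^ (2 - δ)) ∧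
      ∀ n : ℕ, (n : ℝ) ≤ 1 / 3 * δ * |Real.log h| →
        ell2Norm h (fun a => ((japanese a ^ σ : ℝ) : ℂ) *
            ((kravchukFun n h a : ℂ) - gridProj h (fun x => (hermiteFun n x : ℂ)) a))
          ≤ ENNReal.ofReal (C * h ^ (2 - δ)) := by
  obtain ⟨C, hC, hbound⟩ := exists_ell2Norm_rho_sub_le_and_kravchukFun_sub_le σ
  refine ⟨C, ⌈δ ^ 2⌉₊, fun N hN hNe h hh => ?_⟩
  have hδN : δ ^ 2 ≤ N := Nat.ceil_le.1 hN
  have hN0 : 0 < (N : ℝ) := (pow_pos hδ 2).trans_le hδN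
  have h0 : 0 < h := hh ▸ mesh_pos (Nat.cast_pos.1 hN0)
  obtain ⟨M, rfl⟩ := hNe
  have hM : h ^ 2 * M = 1 := by
    have hM0 : (M : ℝ) ≠ 0 := by rintro h0; simp [h0] at hN0
    rw [hh, mesh_sq, Nat.cast_add, ← two_mul]
    field_simp
  have h1 := le_one_of_sq_mul_natCast_eq_one h0 hM
  have hδh : δ * h ≤ 3 := by
    push_cast at hδN
    have : (δ * h) ^ 2 ≤ 2 := by nlinarith [sq_nonneg h]
    nlinarith
  have hpow : h ^ (2 - δ) = h ^ 2 * h ^ (-δ) := by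
    rw [sub_eq_add_neg, Real.rpow_add h0, Real.rpow_two]
  rw [hpow]
  refine ⟨(hbound M h h0 hM).1.trans (ENNReal.ofReal_le_ofReal ?_), fun n hn =>
    ((hbound M h h0 hM).2 n (sq_mul_le_one_of_le_mul_abs_log h0 h1 hδ.le hδh hn)).trans
      (ENNReal.ofReal_le_ofReal ?_)⟩
  · gcongr
    exact le_mul_of_one_le_right (sq_nonneg h)
      (Real.one_le_rpow_of_pos_of_le_one_of_nonpos h0 h1 (by linarith))
  · gcongr
    exact sixteen_pow_le_rpow_neg h0 h1 hn

/-! ### Locally absolutely continuous functions -/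

/-- `f` is a primitive of the locally integrable function `f'`, that is, `f` is locally absolutely
continuous with almost everywhere derivative `f'`. -/
structure IsPrimitive (f f' : ℝ → ℝ) : Prop where
  locallyIntegrable : LocallyIntegrable f'
  eq_add_integral : ∀ x, f x = f 0 + ∫ t in (0 : ℝ)..x, f' t

namespace IsPrimitive

variable {f f' g g' : ℝ → ℝ}

lemma const_add_integral (hf' : LocallyIntegrable f') (c : ℝ) :
    IsPrimitive (fun x => c + ∫ t in (0 : ℝ)..x, f' t) f' :=
  ⟨hf', fun x => by simp⟩

lemma of_hasDerivAt (hf : ∀ x, HasDerivAt f (f' x) x) (hf' : Continuous f') : IsPrimitive f f' :=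
  ⟨hf'.locallyIntegrable, fun x => by
    rw [intervalIntegral.integral_eq_sub_of_hasDerivAt (fun t _ => hf t)
      (hf'.intervalIntegrable _ _), add_sub_cancel]⟩

lemma congr_deriv (hf : IsPrimitive f f') (h : f' =ᵐ[volume] g') : IsPrimitive f g' :=
  ⟨hf.locallyIntegrable.congr h, fun x => by
    rw [hf.eq_add_integral x, intervalIntegral.integral_congr_ae (h.mono fun t ht _ => ht)]⟩

lemma intervalIntegrable (hf : IsPrimitive f f') (a b : ℝ) : IntervalIntegrable f' volume a b :=
  intervalIntegrable_iff.2 <|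
    (hf.locallyIntegrable.integrableOn_isCompact isCompact_uIcc).mono_set Set.uIoc_subset_uIcc

lemma continuous (hf : IsPrimitive f f') : Continuous f := by
  rw [funext hf.eq_add_integral]
  exact continuous_const.add (intervalIntegral.continuous_primitive hf.intervalIntegrable 0)

lemma hasDerivAt (hf : IsPrimitive f f') (hf' : Continuous f') (x : ℝ) :
    HasDerivAt f (f' x) x := by
  rw [funext hf.eq_add_integral]
  exact (hf'.integral_hasStrictDerivAt 0 x).hasDerivAt.const_add _

lemma ae_hasDerivAt (hf : IsPrimitive f f') : ∀ᵐ x, HasDerivAt f (f' x) x := by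
  filter_upwards [_root_.LocallyIntegrable.ae_hasDerivAt_integral hf.locallyIntegrable] with x hx
  rw [funext hf.eq_add_integral]
  exact (hx 0).const_add _

lemma absolutelyContinuousOnInterval (hf : IsPrimitive f f') (x : ℝ) :
    AbsolutelyContinuousOnInterval f 0 x := by
  rw [funext hf.eq_add_integral]
  exact (contDiff_const.contDiffOn.absolutelyContinuousOnInterval).add
    ((hf.intervalIntegrable 0 x).absolutelyContinuousOnInterval_intervalIntegral (by simp))

lemma mul (hf : IsPrimitive f f') (hg : IsPrimitive g g') :
    IsPrimitive (fun x => f x * g x) (fun x => f' x * g x + f x * g' x) := by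
  have hl : LocallyIntegrable (fun x => f' x * g x) := locallyIntegrable_iff.2 fun K hK =>
    (hf.locallyIntegrable.integrableOn_isCompact hK).mul_continuousOn hg.continuous.continuousOn hK
  have hr : LocallyIntegrable (fun x => f x * g' x) := locallyIntegrable_iff.2 fun K hK =>
    (hg.locallyIntegrable.integrableOn_isCompact hK).continuousOn_mul hf.continuous.continuousOn hK
  refine ⟨hl.add hr, fun x => ?_⟩
  have hparts : ∫ t in (0 : ℝ)..x, (f' t * g t + f t * g' t) = f x * g x - f 0 * g 0 := by
    rw [← (hf.absolutelyContinuousOnInterval x).integral_deriv_mul_eq_sub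
      (hg.absolutelyContinuousOnInterval x)]
    refine intervalIntegral.integral_congr_ae ?_
    filter_upwards [hf.ae_hasDerivAt, hg.ae_hasDerivAt] with t hft hgt _
    rw [hft.deriv, hgt.deriv]
  rw [hparts, add_sub_cancel]

lemma integral_Ioi_eq_neg (hf : IsPrimitive f f') (hf' : Integrable f') (hfi : Integrable f) :
    ∫ t in Set.Ioi 0, f' t = -f 0 := by
  have hlim : Filter.Tendsto f Filter.atTop (nhds (f 0 + ∫ t in Set.Ioi 0, f' t)) := by
    rw [funext hf.eq_add_integral]
    simpa using (intervalIntegral_tendsto_integral_Ioi 0 hf'.integrableOn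
      Filter.tendsto_id).const_add (f 0)
  refine eq_neg_of_add_eq_zero_right <| IntegrableAtFilter.eq_zero_of_tendsto
    ⟨Set.univ, Filter.univ_mem, hfi.integrableOn⟩ (fun s hs => ?_) hlim
  obtain ⟨b, hb⟩ := Filter.mem_atTop_sets.1 hs
  rw [← top_le_iff, ← Real.volume_Ici (a := b)]
  exact measure_mono hb

lemma integral_Iic_eq (hf : IsPrimitive f f') (hf' : Integrable f') (hfi : Integrable f) :
    ∫ t in Set.Iic 0, f' t = f 0 := by
  have hlim : Filter.Tendsto f Filter.atBot (nhds (f 0 - ∫ t in Set.Iic 0, f' t)) := by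
    refine ((intervalIntegral_tendsto_integral_Iic 0 hf'.integrableOn
      Filter.tendsto_id).const_sub (f 0)).congr fun x => ?_
    rw [id, intervalIntegral.integral_symm, sub_neg_eq_add, ← hf.eq_add_integral]
  refine (sub_eq_zero.1 <| IntegrableAtFilter.eq_zero_of_tendsto
    ⟨Set.univ, Filter.univ_mem, hfi.integrableOn⟩ (fun s hs => ?_) hlim).symm
  obtain ⟨b, hb⟩ := Filter.mem_atBot_sets.1 hs
  rw [← top_le_iff, ← Real.volume_Iic (a := b)]
  exact measure_mono hb

lemma integral_eq_zero (hf : IsPrimitive f f') (hf' : Integrable f') (hfi : Integrable f) :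
    ∫ x, f' x = 0 := by
  rw [← intervalIntegral.integral_Iic_add_Ioi (b := 0) hf'.integrableOn hf'.integrableOn,
    hf.integral_Iic_eq hf' hfi, hf.integral_Ioi_eq_neg hf' hfi, add_neg_cancel]

end IsPrimitive

/-- `u 0, …, u n` are successive derivatives, each in the almost everywhere sense of
`IsPrimitive`; this is how a function with a weak derivative of order `n` enters the estimates. -/
def IsPrimitiveChain (n : ℕ) (u : ℕ → ℝ → ℝ) : Prop :=
  ∀ k < n, IsPrimitive (u k) (u (k + 1))

namespace IsPrimitiveChain

variable {n k : ℕ} {u : ℕ → ℝ → ℝ}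

lemma continuous (hu : IsPrimitiveChain n u) (hk : k < n) : Continuous (u k) :=
  (hu k hk).continuous

lemma hasDerivAt (hu : IsPrimitiveChain n u) (hk : k + 1 < n) (x : ℝ) :
    HasDerivAt (u k) (u (k + 1) x) x :=
  (hu k (k.lt_succ_self.trans hk)).hasDerivAt (hu.continuous hk) x

end IsPrimitiveChain

/-! ### Weak derivatives -/

lemma exists_contDiff_deriv_eq_of_integral_eq_zero {θ : ℝ → ℝ} (hθ : ContDiff ℝ ∞ θ)
    (hc : HasCompactSupport θ) (h0 : ∫ x, θ x = 0) :
    ∃ Φ : ℝ → ℝ, ContDiff ℝ ∞ Φ ∧ HasCompactSupport Φ ∧ deriv Φ = θ := by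
  obtain ⟨R, hR⟩ := hc.isCompact.isBounded.subset_closedBall 0
  rw [Real.closedBall_eq_Icc, zero_sub, zero_add] at hR
  have hzero (x) (hx : x ∉ Set.Icc (-R) R) : θ x = 0 :=
    image_eq_zero_of_notMem_tsupport fun h => hx (hR h)
  have hfint : Integrable θ := hθ.continuous.integrable_of_hasCompactSupport hc
  have hd (x) : HasDerivAt (fun x => ∫ t in Set.Iic x, θ t) (θ x) x := by
    have hIic (y) : ∫ t in Set.Iic y, θ t = (∫ t in Set.Iic 0, θ t) + ∫ t in (0 : ℝ)..y, θ t := by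
      rw [← intervalIntegral.integral_Iic_sub_Iic hfint.integrableOn hfint.integrableOn,
        add_sub_cancel]
    rw [funext hIic]
    exact (hθ.continuous.integral_hasStrictDerivAt 0 x).hasDerivAt.const_add _
  have hd' : deriv (fun x => ∫ t in Set.Iic x, θ t) = θ := funext fun x => (hd x).deriv
  refine ⟨fun x => ∫ t in Set.Iic x, θ t, ?_, ?_, hd'⟩
  · rw [contDiff_infty_iff_deriv, hd']
    exact ⟨fun x => (hd x).differentiableAt, hθ⟩
  · refine HasCompactSupport.intro (isCompact_Icc (a := -R) (b := R)) fun x hx => ?_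
    rcases lt_or_ge x (-R) with hxR | hxR
    · exact setIntegral_eq_zero_of_forall_eq_zero fun t ht =>
        hzero t fun h => (h.1.trans (Set.mem_Iic.1 ht)).not_gt hxR
    · rw [← h0]
      refine setIntegral_eq_integral_of_forall_compl_eq_zero fun t ht => hzero t fun h => ?_
      exact hx ⟨hxR, (not_le.1 ht).le.trans h.2⟩

lemma ae_eq_const_of_integral_deriv_mul_eq_zero {w : ℝ → ℝ} (hw : LocallyIntegrable w)
    (h : ∀ φ : ℝ → ℝ, ContDiff ℝ ∞ φ → HasCompactSupport φ → ∫ x, deriv φ x * w x = 0) :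
    ∃ c : ℝ, w =ᵐ[volume] fun _ => c := by
  let B : ContDiffBump (0 : ℝ) := default
  set η : ℝ → ℝ := B.normed volume
  have hη : ContDiff ℝ ∞ η := B.contDiff_normed
  have hηc : HasCompactSupport η := B.hasCompactSupport_normed
  have hηi : Integrable η := hη.continuous.integrable_of_hasCompactSupport hηc
  refine ⟨∫ x, η x * w x, ?_⟩
  refine ae_eq_of_integral_contDiff_smul_eq hw (locallyIntegrable_const _) fun φ hφ hφc => ?_
  have hφi : Integrable φ := hφ.continuous.integrable_of_hasCompactSupport hφc
  set d := ∫ x, φ x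
  obtain ⟨Φ, hΦ, hΦc, hΦ'⟩ := exists_contDiff_deriv_eq_of_integral_eq_zero
    (θ := fun x => φ x - d * η x) (hφ.sub (contDiff_const.mul hη))
    (hφc.sub (hηc.mul_left (f := fun _ => d))) (by
      rw [integral_sub hφi (hηi.const_mul d), integral_const_mul, B.integral_normed, mul_one,
        sub_self])
  have hzero := h Φ hΦ hΦc
  simp only [hΦ', sub_mul, mul_assoc] at hzero
  have hφw : Integrable fun x => φ x * w x :=
    hw.integrable_smul_left_of_hasCompactSupport hφ.continuous hφc
  have hηw : Integrable fun x => η x * w x :=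
    hw.integrable_smul_left_of_hasCompactSupport hη.continuous hηc
  rw [integral_sub hφw (hηw.const_mul d), integral_const_mul, sub_eq_zero] at hzero
  simp only [smul_eq_mul]
  rw [hzero, integral_mul_const]

lemma exists_isPrimitive_of_integral_deriv_mul_eq_neg {f v : ℝ → ℝ} (hf : LocallyIntegrable f)
    (hv : LocallyIntegrable v)
    (h : ∀ φ : ℝ → ℝ, ContDiff ℝ ∞ φ → HasCompactSupport φ →
      ∫ x, deriv φ x * f x = -∫ x, φ x * v x) :
    ∃ F : ℝ → ℝ, IsPrimitive F v ∧ f =ᵐ[volume] F := by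
  have hG := IsPrimitive.const_add_integral hv 0
  set G : ℝ → ℝ := fun x => 0 + ∫ t in (0 : ℝ)..x, v t
  have hGl : LocallyIntegrable G := hG.continuous.locallyIntegrable
  have hweak (φ : ℝ → ℝ) (hφ : ContDiff ℝ ∞ φ) (hφc : HasCompactSupport φ) :
      ∫ x, deriv φ x * (f x - G x) = 0 := by
    have hφ' : Continuous (deriv φ) := hφ.continuous_deriv (by simp)
    have hP : IsPrimitive φ (deriv φ) := .of_hasDerivAt
      (fun x => (hφ.differentiable (by simp) x).hasDerivAt) hφ'
    have hφ'G : Integrable fun x => deriv φ x * G x :=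
      hGl.integrable_smul_left_of_hasCompactSupport hφ' hφc.deriv
    have hφv : Integrable fun x => φ x * v x :=
      hv.integrable_smul_left_of_hasCompactSupport hφ.continuous hφc
    have hφ'f : Integrable fun x => deriv φ x * f x :=
      hf.integrable_smul_left_of_hasCompactSupport hφ' hφc.deriv
    have hparts := (hP.mul hG).integral_eq_zero (hφ'G.add hφv)
      (hGl.integrable_smul_left_of_hasCompactSupport hφ.continuous hφc)
    rw [integral_add hφ'G hφv] at hparts
    simp_rw [mul_sub]
    rw [integral_sub hφ'f hφ'G, h φ hφ hφc]
    linarith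
  obtain ⟨c, hc⟩ := ae_eq_const_of_integral_deriv_mul_eq_zero (hf.sub hGl) hweak
  refine ⟨fun x => c + ∫ t in (0 : ℝ)..x, v t, .const_add_integral hv c, ?_⟩
  filter_upwards [hc] with x hx
  simp only [Pi.sub_apply, G, zero_add] at hx
  linarith

namespace IsWeakDeriv

variable {k n : ℕ} {g v w : ℝ → ℂ}

lemma ae_unique (hv : IsWeakDeriv k g v) (hw : IsWeakDeriv k g w) : v =ᵐ[volume] w :=
  ae_eq_of_integral_contDiff_smul_eq hv.1 hw.1 fun φ hφ hφc =>
    mul_left_cancel₀ (pow_ne_zero _ (neg_ne_zero.2 one_ne_zero))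
      ((hv.2 φ hφ hφc).symm.trans (hw.2 φ hφ hφc))

lemma ae_eq_of_zero (hg : LocallyIntegrable g) (hv : IsWeakDeriv 0 g v) : g =ᵐ[volume] v :=
  ae_unique ⟨hg, fun φ _ _ => by simp⟩ hv

lemma integral_deriv_smul (hv : IsWeakDeriv k g v) (hw : IsWeakDeriv (k + 1) g w) {φ : ℝ → ℝ}
    (hφ : ContDiff ℝ ∞ φ) (hφc : HasCompactSupport φ) :
    ∫ x, deriv φ x • v x = -∫ x, φ x • w x := by
  have h := (hv.2 (deriv φ) (contDiff_infty_iff_deriv.1 hφ).2 hφc.deriv).symm.trans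
    (iteratedDeriv_succ' (n := k) (f := φ) ▸ hw.2 φ hφ hφc)
  rw [pow_succ, mul_assoc] at h
  rw [mul_left_cancel₀ (pow_ne_zero _ (neg_ne_zero.2 one_ne_zero)) h, neg_one_mul]

lemma exists_isPrimitive_clm_comp (hv : IsWeakDeriv k g v) (hw : IsWeakDeriv (k + 1) g w)
    (ℓ : ℂ →L[ℝ] ℝ) :
    ∃ F : ℝ → ℝ, IsPrimitive F (fun x => ℓ (w x)) ∧ (fun x => ℓ (v x)) =ᵐ[volume] F := by
  have hcomp {u : ℝ → ℂ} (hu : LocallyIntegrable u volume) :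
      LocallyIntegrable (fun x => ℓ (u x)) volume :=
    locallyIntegrable_iff.2 fun _ hK => ℓ.integrable_comp (hu.integrableOn_isCompact hK)
  refine exists_isPrimitive_of_integral_deriv_mul_eq_neg (hcomp hv.1) (hcomp hw.1)
    fun φ hφ hφc => ?_
  have h := congrArg ℓ (hv.integral_deriv_smul hw hφ hφc)
  rw [map_neg, ← ℓ.integral_comp_comm
      (hv.1.integrable_smul_left_of_hasCompactSupport (hφ.continuous_deriv (by simp)) hφc.deriv),
    ← ℓ.integral_comp_comm
      (hw.1.integrable_smul_left_of_hasCompactSupport hφ.continuous hφc)] at h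
  simpa only [map_smul, smul_eq_mul] using h

lemma exists_isPrimitive_chain {v : ℕ → ℝ → ℂ} (hv : ∀ k ≤ n, IsWeakDeriv k g (v k))
    (ℓ : ℂ →L[ℝ] ℝ) :
    ∃ U : ℕ → ℝ → ℝ, (∀ k ≤ n, (fun x => ℓ (v k x)) =ᵐ[volume] U k) ∧
      IsPrimitiveChain n U := by
  have hex (k : ℕ) : ∃ F : ℝ → ℝ, (k ≤ n → (fun x => ℓ (v k x)) =ᵐ[volume] F) ∧
      (k < n → IsPrimitive F (fun x => ℓ (v (k + 1) x))) := by
    by_cases hk : k < n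
    · obtain ⟨F, hF, hFe⟩ := (hv k hk.le).exists_isPrimitive_clm_comp (hv (k + 1) hk) ℓ
      exact ⟨F, fun _ => hFe, fun _ => hF⟩
    · exact ⟨fun x => ℓ (v k x), fun _ => ae_eq_refl _, fun h => absurd h hk⟩
  choose U hUv hU using hex
  exact ⟨U, hUv, fun k hk => (hU k hk).congr_deriv (hUv (k + 1) hk)⟩

lemma weakDeriv_of_isWeakDeriv (hv : IsWeakDeriv k g v) : IsWeakDeriv k g (weakDeriv k g) := by
  have H : ∃ v, IsWeakDeriv k g v := ⟨v, hv⟩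
  rw [weakDeriv, dif_pos H]
  exact H.choose_spec

end IsWeakDeriv

namespace MemSobolev

variable {k n : ℕ} {g : ℝ → ℂ}

lemma isWeakDeriv_weakDeriv (hg : MemSobolev n g) (hk : k ≤ n) :
    IsWeakDeriv k g (weakDeriv k g) :=
  let ⟨_, _, hv⟩ := hg.2 k hk
  hv.weakDeriv_of_isWeakDeriv

lemma memLp_weakDeriv (hg : MemSobolev n g) (hk : k ≤ n) : MemLp (weakDeriv k g) 2 :=
  let ⟨_, hv2, hv⟩ := hg.2 k hk
  hv2.ae_eq (hv.ae_unique (hg.isWeakDeriv_weakDeriv hk))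

end MemSobolev

/-! ### Weighted interpolation -/

/-- A bounded regularization of the weight `1 + x ^ 2`, which it increases to as `ε` tends
to `0`; it makes the integrations by parts legitimate. -/
noncomputable def regWeight (ε x : ℝ) : ℝ := (1 + x ^ 2) / (1 + ε * x ^ 2)

/-- The derivative of `regWeight ε`. -/
noncomputable def regWeightDeriv (ε x : ℝ) : ℝ := 2 * x * (1 - ε) / (1 + ε * x ^ 2) ^ 2

section regWeight

variable {ε : ℝ}

lemma hasDerivAt_one_add_sq (x : ℝ) : HasDerivAt (fun x : ℝ => 1 + x ^ 2) (2 * x) x := by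
  simpa using (hasDerivAt_pow 2 x).const_add 1

lemma hasDerivAt_regWeight (hε : 0 < ε) (x : ℝ) :
    HasDerivAt (regWeight ε) (regWeightDeriv ε x) x := by
  have hden : HasDerivAt (fun x : ℝ => 1 + ε * x ^ 2) (ε * (2 * x)) x := by
    simpa using ((hasDerivAt_pow 2 x).const_mul ε).const_add 1
  refine ((hasDerivAt_one_add_sq x).fun_div hden (by positivity)).congr_deriv ?_
  rw [regWeightDeriv]
  congr 1
  ring

lemma continuous_regWeight (hε : 0 < ε) : Continuous (regWeight ε) :=
  continuous_iff_continuousAt.2 fun x => (hasDerivAt_regWeight hε x).continuousAt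

lemma continuous_regWeightDeriv (hε : 0 < ε) : Continuous (regWeightDeriv ε) := by
  unfold regWeightDeriv
  exact Continuous.div (by fun_prop) (by fun_prop) fun x => by positivity

lemma regWeight_pos (hε : 0 < ε) (x : ℝ) : 0 < regWeight ε x := by
  unfold regWeight
  positivity

lemma regWeight_pow_mul_sq_nonneg (hε : 0 < ε) (j : ℕ) (x y : ℝ) :
    0 ≤ regWeight ε x ^ j * y ^ 2 :=
  mul_nonneg (pow_nonneg (regWeight_pos hε x).le j) (sq_nonneg y)

lemma one_le_regWeight (hε : 0 < ε) (hε1 : ε ≤ 1) (x : ℝ) : 1 ≤ regWeight ε x := by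
  rw [regWeight, one_le_div (by positivity)]
  linarith [mul_le_of_le_one_left (sq_nonneg x) hε1]

lemma regWeight_le_one_add_sq (hε : 0 < ε) (x : ℝ) : regWeight ε x ≤ 1 + x ^ 2 :=
  div_le_self (by positivity) (le_add_of_nonneg_right (by positivity))

lemma regWeight_le_inv (hε : 0 < ε) (hε1 : ε ≤ 1) (x : ℝ) : regWeight ε x ≤ ε⁻¹ := by
  rw [regWeight, div_le_iff₀ (by positivity), mul_add, inv_mul_cancel_left₀ hε.ne', mul_one]
  gcongr
  exact (one_le_inv₀ hε).2 hε1

lemma regWeightDeriv_sq_le (hε : 0 < ε) (hε1 : ε ≤ 1) (x : ℝ) :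
    regWeightDeriv ε x ^ 2 ≤ 4 * regWeight ε x := by
  rw [regWeight, regWeightDeriv, div_pow, mul_div_assoc',
    div_le_div_iff₀ (by positivity) (by positivity), ← pow_mul]
  have hnum : (2 * x * (1 - ε)) ^ 2 ≤ 4 * (1 + x ^ 2) := by
    have : (1 - ε) ^ 2 ≤ 1 := pow_le_one₀ (by linarith) (by linarith)
    linarith [mul_le_of_le_one_right (sq_nonneg x) this, mul_pow (2 * x) (1 - ε) 2, mul_pow 2 x 2]
  have hden : 1 + ε * x ^ 2 ≤ (1 + ε * x ^ 2) ^ (2 * 2) :=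
    le_self_pow₀ (le_add_of_nonneg_right (by positivity)) (by norm_num)
  exact mul_le_mul hnum hden (by positivity) (by positivity)

lemma abs_regWeightDeriv_le (hε : 0 < ε) (hε1 : ε ≤ 1) (x : ℝ) :
    |regWeightDeriv ε x| ≤ 2 * ε⁻¹ := by
  have hinv := (one_le_inv₀ hε).2 hε1
  refine abs_le_of_sq_le_sq ?_ (by positivity)
  calc regWeightDeriv ε x ^ 2 ≤ 4 * regWeight ε x := regWeightDeriv_sq_le hε hε1 x
    _ ≤ 4 * ε⁻¹ := by gcongr; exact regWeight_le_inv hε hε1 x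
    _ ≤ (2 * ε⁻¹) ^ 2 := by nlinarith

lemma tendsto_regWeight (x : ℝ) :
    Filter.Tendsto (fun ε => regWeight ε x) (nhds 0) (nhds (1 + x ^ 2)) := by
  have hcont : ContinuousAt (fun ε : ℝ => (1 + x ^ 2) / (1 + ε * x ^ 2)) 0 :=
    ContinuousAt.div (by fun_prop) (by fun_prop) (by simp)
  simpa [ContinuousAt, regWeight] using hcont

lemma integrable_regWeight_pow_mul (hε : 0 < ε) (hε1 : ε ≤ 1) (j : ℕ) {f : ℝ → ℝ}
    (hf : Integrable f) : Integrable fun x => regWeight ε x ^ j * f x := by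
  refine hf.bdd_mul (c := ε⁻¹ ^ j) ((continuous_regWeight hε).pow j).aestronglyMeasurable
    (ae_of_all _ fun x => ?_)
  rw [norm_pow, Real.norm_of_nonneg (regWeight_pos hε x).le]
  exact pow_le_pow_left₀ (regWeight_pos hε x).le (regWeight_le_inv hε hε1 x) j

end regWeight

-- After division by `q ^ l`, one completes the squares in `(a, b)` and in `(a, c)`.
lemma half_mul_sq_le_add {q q' η : ℝ} (a b c : ℝ) (l : ℕ) (hq : 1 ≤ q) (hq' : q' ^ 2 ≤ 4 * q)
    (hη : 0 < η) :
    q ^ (l + 1) * b ^ 2 / 2 ≤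
      (l + 1) * q ^ l * q' * (a * b) + q ^ (l + 1) * (b * b + a * c)
        + (2 * (l + 1) ^ 2 + 1 / (2 * η)) * (q ^ (l + 2) * a ^ 2) + η / 2 * (q ^ l * c ^ 2) := by
  have hq0 : 0 < q := by linarith
  set L : ℝ := l + 1
  have hab : 0 ≤ q * b ^ 2 / 2 + L * q' * (a * b) + 2 * L ^ 2 * a ^ 2 := by
    refine nonneg_of_mul_nonneg_right ?_ hq0
    nlinarith [sq_nonneg (q * b + L * q' * a), mul_nonneg (sq_nonneg (L * a)) (sub_nonneg.2 hq')]
  have hac : 0 ≤ q * (a * c) + 1 / (2 * η) * (q ^ 2 * a ^ 2) + η / 2 * c ^ 2 := by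
    have hsq : q * (a * c) + 1 / (2 * η) * (q ^ 2 * a ^ 2) + η / 2 * c ^ 2
        = 1 / (2 * η) * (q * a + η * c) ^ 2 := by
      field_simp
      ring
    rw [hsq]
    positivity
  have haa : 2 * L ^ 2 * a ^ 2 ≤ 2 * L ^ 2 * (q ^ 2 * a ^ 2) := by
    gcongr
    exact le_mul_of_one_le_left (sq_nonneg a) (one_le_pow₀ hq)
  have hsum : 0 ≤ q ^ l * (L * q' * (a * b) + q * b ^ 2 / 2 + q * (a * c)
      + (2 * L ^ 2 + 1 / (2 * η)) * (q ^ 2 * a ^ 2) + η / 2 * c ^ 2) :=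
    mul_nonneg (by positivity) (by linarith)
  linear_combination hsum

lemma integral_regWeight_pow_mul_sq_le {ε η : ℝ} (hε : 0 < ε) (hε1 : ε ≤ 1) (hη : 0 < η) (l : ℕ)
    {f₀ f₁ f₂ : ℝ → ℝ} (h01 : IsPrimitive f₀ f₁) (h12 : IsPrimitive f₁ f₂)
    (m0 : MemLp f₀ 2) (m1 : MemLp f₁ 2) (m2 : MemLp f₂ 2) :
    ∫ x, regWeight ε x ^ (l + 1) * f₁ x ^ 2
      ≤ η * (∫ x, regWeight ε x ^ l * f₂ x ^ 2)
        + (4 * (l + 1) ^ 2 + 1 / η) * ∫ x, regWeight ε x ^ (l + 2) * f₀ x ^ 2 := by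
  have hfint (j : ℕ) {f : ℝ → ℝ} (hf : Integrable f) :=
    integrable_regWeight_pow_mul hε hε1 j hf
  have hcont := continuous_regWeight hε
  have hcont' := continuous_regWeightDeriv hε
  have hpow : IsPrimitive (fun x => regWeight ε x ^ (l + 1))
      (fun x => (l + 1) * regWeight ε x ^ l * regWeightDeriv ε x) :=
    .of_hasDerivAt (fun x => by simpa using (hasDerivAt_regWeight hε x).fun_pow (l + 1))
      (by fun_prop)
  have hi₁ : Integrable fun x =>
      (l + 1) * regWeight ε x ^ l * regWeightDeriv ε x * (f₀ x * f₁ x) := by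
    simp_rw [mul_assoc]
    exact (hfint l ((m0.integrable_mul m1).bdd_mul hcont'.aestronglyMeasurable
      (ae_of_all _ (abs_regWeightDeriv_le hε hε1)))).const_mul _
  have hi₂ : Integrable fun x => regWeight ε x ^ (l + 1) * (f₁ x * f₁ x + f₀ x * f₂ x) :=
    hfint _ ((m1.integrable_mul m1).add (m0.integrable_mul m2))
  have hparts := (hpow.mul (h01.mul h12)).integral_eq_zero (hi₁.add hi₂)
    (hfint _ (m0.integrable_mul m1))
  have hsq₀ := (hfint (l + 2) m0.integrable_sq).const_mul (2 * ((l : ℝ) + 1) ^ 2 + 1 / (2 * η))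
  have hsq₂ := (hfint l m2.integrable_sq).const_mul (η / 2)
  have hmono := integral_mono ((hfint (l + 1) m1.integrable_sq).div_const 2)
    (((hi₁.fun_add hi₂).fun_add hsq₀).fun_add hsq₂) fun x =>
      half_mul_sq_le_add (f₀ x) (f₁ x) (f₂ x) l (one_le_regWeight hε hε1 x)
        (regWeightDeriv_sq_le hε hε1 x) hη
  rw [integral_add ((hi₁.fun_add hi₂).fun_add hsq₀) hsq₂, integral_add (hi₁.fun_add hi₂) hsq₀,
    hparts, integral_div, integral_const_mul, integral_const_mul] at hmono
  linear_combination 2 * hmono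

section ThreeTerm

variable {c : ℝ}

lemma exists_le_add_mul_of_three_term (hc : 0 ≤ c) (k : ℕ) {η : ℝ} (hη : 0 < η) :
    ∃ C, 0 ≤ C ∧ ∀ A : ℕ → ℝ, (∀ j, 0 ≤ A j) →
      (∀ j < k, ∀ η > 0, A (j + 1) ≤ η * A (j + 2) + (c + 1 / η) * A j) →
      A k ≤ η * A (k + 1) + C * A 0 := by
  induction k generalizing η with
  | zero =>
    exact ⟨1, zero_le_one, fun A hA _ => by linarith [mul_nonneg hη.le (hA (0 + 1))]⟩
  | succ k ih =>
    set d := c + 1 / (η / 2) with hd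
    have hd0 : 0 < d := by positivity
    obtain ⟨C, hC, hCA⟩ := ih (η := 1 / (2 * d)) (by positivity)
    refine ⟨2 * d * C, by positivity, fun A hA hrec => ?_⟩
    have hk : d * A k ≤ A (k + 1) / 2 + d * C * A 0 :=
      calc d * A k ≤ d * (1 / (2 * d) * A (k + 1) + C * A 0) := by
            gcongr
            exact hCA A hA fun j hj => hrec j (hj.trans k.lt_succ_self)
        _ = A (k + 1) / 2 + d * C * A 0 := by field_simp
    have hk' := hrec k k.lt_succ_self (η / 2) (by positivity)
    rw [← hd] at hk'
    linarith

lemma exists_le_last_add_mul_of_three_term (hc : 0 ≤ c) (n : ℕ) :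
    ∃ C, 0 ≤ C ∧ ∀ A : ℕ → ℝ, (∀ j, 0 ≤ A j) →
      (∀ j, j + 2 ≤ n → ∀ η > 0, A (j + 1) ≤ η * A (j + 2) + (c + 1 / η) * A j) →
      ∀ k ≤ n, A k ≤ A n + C * A 0 := by
  choose C hC hCA using fun k => exists_le_add_mul_of_three_term hc k zero_lt_one
  refine ⟨∑ j ∈ Finset.range n, C j, Finset.sum_nonneg fun j _ => hC j, fun A hA hrec k hk => ?_⟩
  have htelescope : A k ≤ A n + (∑ j ∈ Finset.Ico k n, C j) * A 0 := by
    induction hk using Nat.decreasingInduction with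
    | self => simp
    | of_succ k hk ih =>
      rw [Finset.sum_eq_sum_Ico_succ_bot hk]
      linarith [hCA k A hA fun j hj => hrec j (by lia)]
  refine htelescope.trans ?_
  gcongr
  · exact hA 0
  · exact fun j _ _ => hC j
  · exact Finset.range_eq_Ico n ▸ Finset.Ico_subset_Ico_left k.zero_le

end ThreeTerm

/-- The sum of the squares of `⟨x⟩ ^ (n - k) u k` over `k < n`, for successive derivatives `u`. It
controls the values of `u` on cells, while its integral is controlled by the `Σⁿ` norm. -/
noncomputable def sigmaDensity (n : ℕ) (u : ℕ → ℝ → ℝ) (x : ℝ) : ℝ :=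
  ∑ k ∈ Finset.range n, (1 + x ^ 2) ^ (n - k) * u k x ^ 2

/-- The analogue of `sigmaDensity n u` for the regularized weight. -/
noncomputable def regSigmaDensity (ε : ℝ) (n : ℕ) (u : ℕ → ℝ → ℝ) (x : ℝ) : ℝ :=
  ∑ k ∈ Finset.range n, regWeight ε x ^ (n - k) * u k x ^ 2

section sigmaDensity

variable {n : ℕ} {u : ℕ → ℝ → ℝ} {ε : ℝ}

lemma integrable_regWeight_pow_mul_sq (hu : ∀ k ≤ n, MemLp (u k) 2) (hε : 0 < ε) (hε1 : ε ≤ 1)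
    {k : ℕ} (hk : k ≤ n) : Integrable fun x => regWeight ε x ^ (n - k) * u k x ^ 2 :=
  integrable_regWeight_pow_mul hε hε1 _ (hu k hk).integrable_sq

lemma integrable_regSigmaDensity (hu : ∀ k ≤ n, MemLp (u k) 2) (hε : 0 < ε) (hε1 : ε ≤ 1) :
    Integrable (regSigmaDensity ε n u) :=
  integrable_finsetSum _ fun _ hk =>
    integrable_regWeight_pow_mul_sq hu hε hε1 (Finset.mem_range.1 hk).le

lemma regSigmaDensity_nonneg (hε : 0 < ε) (x : ℝ) : 0 ≤ regSigmaDensity ε n u x :=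
  Finset.sum_nonneg fun _ _ => regWeight_pow_mul_sq_nonneg hε _ x _

lemma tendsto_regSigmaDensity (x : ℝ) :
    Filter.Tendsto (fun ε => regSigmaDensity ε n u x) (nhds 0) (nhds (sigmaDensity n u x)) :=
  tendsto_finsetSum _ fun _ _ => ((tendsto_regWeight x).pow _).mul_const _

lemma integral_regWeight_pow_mul_sq_le_of_chain (hu : IsPrimitiveChain n u)
    (hL : ∀ k ≤ n, MemLp (u k) 2) (hε : 0 < ε) (hε1 : ε ≤ 1) {j : ℕ} (hj : j + 2 ≤ n) {η : ℝ}
    (hη : 0 < η) :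
    ∫ x, regWeight ε x ^ (n - (j + 1)) * u (j + 1) x ^ 2
      ≤ η * (∫ x, regWeight ε x ^ (n - (j + 2)) * u (j + 2) x ^ 2)
        + (4 * n ^ 2 + 1 / η) * ∫ x, regWeight ε x ^ (n - j) * u j x ^ 2 := by
  obtain ⟨l, rfl⟩ := Nat.exists_eq_add_of_le' hj
  have hstep := integral_regWeight_pow_mul_sq_le hε hε1 hη l (hu j (by lia))
    (hu (j + 1) (by lia)) (hL j (by lia)) (hL (j + 1) (by lia)) (hL (j + 2) hj)
  rw [show l + (j + 2) - (j + 1) = l + 1 by lia, Nat.add_sub_cancel,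
    show l + (j + 2) - j = l + 2 by lia]
  refine hstep.trans ?_
  gcongr
  · exact integral_nonneg fun x => regWeight_pow_mul_sq_nonneg hε _ x _
  · push_cast
    linarith

lemma exists_integral_regSigmaDensity_le (n : ℕ) : ∃ C, 0 ≤ C ∧ ∀ u : ℕ → ℝ → ℝ,
    IsPrimitiveChain n u → (∀ k ≤ n, MemLp (u k) 2) → ∀ ε, 0 < ε → ε ≤ 1 →
      ∫ x, regSigmaDensity ε n u x
        ≤ C * ((∫ x, regWeight ε x ^ n * u 0 x ^ 2) + ∫ x, u n x ^ 2) := by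
  obtain ⟨C, hC, hCA⟩ := exists_le_last_add_mul_of_three_term (c := 4 * n ^ 2) (by positivity) n
  refine ⟨n * (1 + C), by positivity, fun u hu hL ε hε hε1 => ?_⟩
  set A : ℕ → ℝ := fun k => ∫ x, regWeight ε x ^ (n - k) * u k x ^ 2 with hA
  have hA0 (k : ℕ) : 0 ≤ A k := integral_nonneg fun x => regWeight_pow_mul_sq_nonneg hε _ x _
  have hAn : ∫ x, u n x ^ 2 = A n := by simp [hA]
  calc ∫ x, regSigmaDensity ε n u x = ∑ k ∈ Finset.range n, A k :=
        integral_finsetSum _ fun k hk =>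
          integrable_regWeight_pow_mul_sq hL hε hε1 (Finset.mem_range.1 hk).le
    _ ≤ ∑ _ ∈ Finset.range n, (A n + C * A 0) := Finset.sum_le_sum fun k hk =>
        hCA A hA0 (fun j hj η hη =>
          integral_regWeight_pow_mul_sq_le_of_chain hu hL hε hε1 hj hη) k
          (Finset.mem_range.1 hk).le
    _ = n * (A n + C * A 0) := by rw [Finset.sum_const, Finset.card_range, nsmul_eq_mul]
    _ ≤ n * ((1 + C) * (A 0 + A n)) := by
        gcongr
        linarith [hA0 0, mul_nonneg hC (hA0 n)]
    _ = n * (1 + C) * ((∫ x, regWeight ε x ^ n * u 0 x ^ 2) + ∫ x, u n x ^ 2) := by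
        rw [mul_assoc, hAn]
        rfl

lemma exists_lintegral_regSigmaDensity_le (n : ℕ) : ∃ C, 0 ≤ C ∧ ∀ u : ℕ → ℝ → ℝ,
    IsPrimitiveChain n u → (∀ k ≤ n, MemLp (u k) 2) → ∀ ε, 0 < ε → ε ≤ 1 →
      ∫⁻ x, ENNReal.ofReal (regSigmaDensity ε n u x) ≤ ENNReal.ofReal C *
        ((∫⁻ x, ENNReal.ofReal ((1 + x ^ 2) ^ n * u 0 x ^ 2))
          + ∫⁻ x, ENNReal.ofReal (u n x ^ 2)) := by
  obtain ⟨C, hC, hCu⟩ := exists_integral_regSigmaDensity_le n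
  refine ⟨C, hC, fun u hu hL ε hε hε1 => ?_⟩
  have hnn (x : ℝ) := regWeight_pow_mul_sq_nonneg hε n x (u 0 x)
  rw [← ofReal_integral_eq_lintegral_ofReal (integrable_regSigmaDensity hL hε hε1)
    (ae_of_all _ (regSigmaDensity_nonneg hε))]
  refine (ENNReal.ofReal_le_ofReal (hCu u hu hL ε hε hε1)).trans ?_
  rw [ENNReal.ofReal_mul hC, ENNReal.ofReal_add (integral_nonneg hnn)
    (integral_nonneg fun x => sq_nonneg _),
    ofReal_integral_eq_lintegral_ofReal
      (integrable_regWeight_pow_mul hε hε1 n (hL 0 n.zero_le).integrable_sq) (ae_of_all _ hnn),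
    ofReal_integral_eq_lintegral_ofReal (hL n le_rfl).integrable_sq
      (ae_of_all _ fun x => sq_nonneg _)]
  gcongr with x
  · exact (regWeight_pos hε x).le
  · exact regWeight_le_one_add_sq hε x

lemma exists_lintegral_sigmaDensity_le (n : ℕ) : ∃ C, 0 ≤ C ∧ ∀ u : ℕ → ℝ → ℝ,
    IsPrimitiveChain n u → (∀ k ≤ n, MemLp (u k) 2) →
    ∫⁻ x, ENNReal.ofReal (sigmaDensity n u x) ≤ ENNReal.ofReal C *
      ((∫⁻ x, ENNReal.ofReal ((1 + x ^ 2) ^ n * u 0 x ^ 2))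
        + ∫⁻ x, ENNReal.ofReal (u n x ^ 2)) := by
  obtain ⟨C, hC, hCu⟩ := exists_lintegral_regSigmaDensity_le n
  refine ⟨C, hC, fun u hu hL => ?_⟩
  set ε : ℕ → ℝ := fun m => 1 / ((m : ℝ) + 1)
  have hε (m : ℕ) : 0 < ε m := by positivity
  have hε1 (m : ℕ) : ε m ≤ 1 := div_le_one_of_le₀ (by simp) (by positivity)
  have hlim (x : ℝ) : Filter.Tendsto (fun m => ENNReal.ofReal (regSigmaDensity (ε m) n u x))
      Filter.atTop (nhds (ENNReal.ofReal (sigmaDensity n u x))) :=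
    ((ENNReal.continuous_ofReal.tendsto _).comp (tendsto_regSigmaDensity x)).comp
      tendsto_one_div_add_atTop_nhds_zero_nat
  calc ∫⁻ x, ENNReal.ofReal (sigmaDensity n u x)
      = ∫⁻ x, Filter.liminf (fun m => ENNReal.ofReal (regSigmaDensity (ε m) n u x))
          Filter.atTop := by simp_rw [(hlim _).liminf_eq]
    _ ≤ Filter.liminf (fun m => ∫⁻ x, ENNReal.ofReal (regSigmaDensity (ε m) n u x))
          Filter.atTop :=
        lintegral_liminf_le' fun m =>
          (integrable_regSigmaDensity hL (hε m) (hε1 m)).1.aemeasurable.ennreal_ofReal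
    _ ≤ _ := by
        refine Filter.liminf_le_of_le (by isBoundedDefault) fun b hb => ?_
        obtain ⟨m, hm⟩ := hb.exists
        exact hm.trans (hCu u hu hL (ε m) (hε m) (hε1 m))

end sigmaDensity

/-! ### Consistency of the discrete oscillator -/

section Cell

lemma abs_sub_le_mul_of_hasDerivAt {f f' : ℝ → ℝ} {c d B : ℝ} (hcd : c ≤ d)
    (hf : ∀ x, HasDerivAt f (f' x) x) (hB : ∀ x ∈ Set.Icc c d, |f' x| ≤ B) :
    |f d - f c| ≤ B * (d - c) :=
  norm_image_sub_le_of_norm_deriv_le_segment' (fun x _ => (hf x).hasDerivWithinAt)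
    (fun x hx => hB x (Set.Ico_subset_Icc_self hx)) d (Set.right_mem_Icc.2 hcd)

lemma sq_intervalIntegral_le {f : ℝ → ℝ} (hf : Continuous f) {c d : ℝ} (hcd : c ≤ d) :
    (∫ t in c..d, f t) ^ 2 ≤ (d - c) * ∫ t in c..d, f t ^ 2 := by
  rcases hcd.eq_or_lt with rfl | hcd'
  · simp
  set I := ∫ t in c..d, f t
  have hfint {g : ℝ → ℝ} (hg : Continuous g) : IntervalIntegrable g volume c d :=
    hg.intervalIntegrable _ _
  have hvar : 0 ≤ ∫ t in c..d, ((d - c) ^ 2 * f t ^ 2 - 2 * (d - c) * I * f t + I ^ 2) :=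
    intervalIntegral.integral_nonneg hcd fun t _ => by
      linarith [sq_nonneg ((d - c) * f t - I)]
  rw [intervalIntegral.integral_add (hfint (by fun_prop)) (hfint (by fun_prop)),
    intervalIntegral.integral_sub (hfint (by fun_prop)) (hfint (by fun_prop)),
    intervalIntegral.integral_const_mul, intervalIntegral.integral_const_mul,
    intervalIntegral.integral_const, smul_eq_mul] at hvar
  refine le_of_sub_nonneg (nonneg_of_mul_nonneg_right ?_ (sub_pos.2 hcd'))
  linear_combination hvar

lemma abs_le_one_add_sq (x : ℝ) : |x| ≤ 1 + x ^ 2 := by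
  linarith [two_mul_le_add_sq |x| 1, sq_abs x, abs_nonneg x]

lemma abs_one_sub_sq_le (x : ℝ) : |1 - x ^ 2| ≤ 1 + x ^ 2 :=
  abs_le.2 ⟨by linarith [sq_nonneg x], by linarith [sq_nonneg x]⟩

lemma one_add_sq_le_of_mem_Icc {a h x : ℝ} (h1 : h ≤ 1) (hx : x ∈ Set.Icc (a - h) (a + h)) :
    1 + a ^ 2 ≤ 3 * (1 + x ^ 2) := by
  have hsq : (a - x) ^ 2 ≤ 1 :=
    (sq_le_one_iff_abs_le_one _).2 (abs_le.2 ⟨by linarith [hx.2], by linarith [hx.1]⟩)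
  nlinarith [sq_nonneg (a - 2 * x)]

variable {n j k : ℕ} {u : ℕ → ℝ → ℝ} {a b h x : ℝ}

lemma sigmaDensity_nonneg (n : ℕ) (u : ℕ → ℝ → ℝ) (x : ℝ) : 0 ≤ sigmaDensity n u x :=
  Finset.sum_nonneg fun _ _ => by positivity

lemma continuous_sigmaDensity (hu : IsPrimitiveChain n u) : Continuous (sigmaDensity n u) :=
  continuous_finsetSum _ fun k hk => by
    have := hu.continuous (Finset.mem_range.1 hk)
    fun_prop

lemma intervalIntegrable_sigmaDensity (hu : IsPrimitiveChain n u) (c d : ℝ) :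
    IntervalIntegrable (sigmaDensity n u) volume c d :=
  (continuous_sigmaDensity hu).intervalIntegrable c d

lemma one_add_sq_pow_mul_sq_le_sigmaDensity (hk : k < n) (hj : j + k ≤ n) (x : ℝ) :
    (1 + x ^ 2) ^ j * u k x ^ 2 ≤ sigmaDensity n u x :=
  calc (1 + x ^ 2) ^ j * u k x ^ 2 ≤ (1 + x ^ 2) ^ (n - k) * u k x ^ 2 := by
        gcongr
        · exact le_add_of_nonneg_right (sq_nonneg x)
        · lia
    _ ≤ sigmaDensity n u x :=
        Finset.single_le_sum (f := fun k => (1 + x ^ 2) ^ (n - k) * u k x ^ 2)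
          (fun _ _ => by positivity) (Finset.mem_range.2 hk)

lemma hasDerivAt_one_add_sq_pow_mul (hu : IsPrimitiveChain n u) (hk : k + 1 < n) (j : ℕ) (x : ℝ) :
    HasDerivAt (fun x => (1 + x ^ 2) ^ j * u k x)
      (j * (1 + x ^ 2) ^ (j - 1) * (2 * x) * u k x + (1 + x ^ 2) ^ j * u (k + 1) x) x :=
  ((hasDerivAt_one_add_sq x).fun_pow j).mul (hu.hasDerivAt hk x)

lemma sq_add_sq_deriv_le_sigmaDensity (hk : k + 1 < n) (hj : 2 * j + k + 1 ≤ n) (x : ℝ) :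
    ((1 + x ^ 2) ^ j * u k x) ^ 2
      + (j * (1 + x ^ 2) ^ (j - 1) * (2 * x) * u k x + (1 + x ^ 2) ^ j * u (k + 1) x) ^ 2
      ≤ (8 * j ^ 2 + 3) * sigmaDensity n u x := by
  set w := 1 + x ^ 2
  have hw : 0 ≤ w := by positivity
  have hcoeff : |j * w ^ (j - 1) * (2 * x)| ≤ 2 * j * w ^ j := by
    rcases j with _ | j
    · simp
    · rw [abs_mul, abs_mul, abs_mul, Nat.abs_cast, abs_of_nonneg (pow_nonneg hw _),
        abs_two, Nat.add_sub_cancel, pow_succ]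
      linear_combination (2 * (j + 1 : ℕ) * w ^ j) * abs_le_one_add_sq x
  have hk₀ : w ^ (2 * j) * u k x ^ 2 ≤ sigmaDensity n u x :=
    one_add_sq_pow_mul_sq_le_sigmaDensity (by lia) (by lia) x
  have hk₁ : w ^ (2 * j) * u (k + 1) x ^ 2 ≤ sigmaDensity n u x :=
    one_add_sq_pow_mul_sq_le_sigmaDensity hk (by lia) x
  have hcross : (j * w ^ (j - 1) * (2 * x) * u k x) ^ 2 ≤ 4 * j ^ 2 * sigmaDensity n u x :=
    calc (j * w ^ (j - 1) * (2 * x) * u k x) ^ 2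
        = |j * w ^ (j - 1) * (2 * x)| ^ 2 * u k x ^ 2 := by rw [mul_pow, sq_abs]
      _ ≤ (2 * j * w ^ j) ^ 2 * u k x ^ 2 := by gcongr
      _ = 4 * j ^ 2 * (w ^ (2 * j) * u k x ^ 2) := by ring
      _ ≤ 4 * j ^ 2 * sigmaDensity n u x := by gcongr
  have hadd := add_sq_le (a := j * w ^ (j - 1) * (2 * x) * u k x) (b := w ^ j * u (k + 1) x)
  linear_combination hadd + 2 * hcross + hk₀ + 2 * hk₁

lemma mul_sq_le_integral_sigmaDensity (hh : 0 ≤ h) (h1 : h ≤ 1) (hu : IsPrimitiveChain n u)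
    (hk : k + 1 < n) (hj : 2 * j + k + 1 ≤ n) (hx : x ∈ Set.Icc (a - h) (a + h)) :
    h * ((1 + x ^ 2) ^ j * u k x) ^ 2
      ≤ (12 * j ^ 2 + 5) * ∫ t in (a - h)..(a + h), sigmaDensity n u t := by
  have hc := hu.continuous (k.lt_succ_self.trans hk)
  have hc' := hu.continuous hk
  have hsobolev := sub_mul_sq_le_integral_sq_add_sq
    (hasDerivAt_one_add_sq_pow_mul hu hk j) (by fun_prop) hx
  have hmono := intervalIntegral.integral_mono_on (a := a - h) (b := a + h) (by linarith)
    ((by fun_prop : Continuous fun t => ((1 + t ^ 2) ^ j * u k t) ^ 2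
      + (j * (1 + t ^ 2) ^ (j - 1) * (2 * t) * u k t
        + (1 + t ^ 2) ^ j * u (k + 1) t) ^ 2).intervalIntegrable _ _)
    ((intervalIntegrable_sigmaDensity hu _ _).const_mul _)
    fun t _ => sq_add_sq_deriv_le_sigmaDensity hk hj t
  rw [intervalIntegral.integral_const_mul] at hmono
  set S := ∫ t in (a - h)..(a + h), sigmaDensity n u t
  have hS : 0 ≤ S :=
    intervalIntegral.integral_nonneg (by linarith) fun t _ => sigmaDensity_nonneg n u t
  have hle : (1 + (a + h - (a - h))) * ((8 * j ^ 2 + 3) * S) ≤ 3 * ((8 * j ^ 2 + 3) * S) := by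
    gcongr
    linarith
  have := mul_le_mul_of_nonneg_left hmono (by linarith : 0 ≤ 1 + (a + h - (a - h)))
  linarith

lemma sq_sub_le_integral_sigmaDensity (hu : IsPrimitiveChain n u) (hk : k + 1 < n) {c d y : ℝ}
    (hcx : c ≤ x) (hxy : x ≤ y) (hyd : y ≤ d) :
    (u k y - u k x) ^ 2 ≤ (d - c) * ∫ t in c..d, sigmaDensity n u t := by
  have hc := hu.continuous hk
  calc (u k y - u k x) ^ 2 = (∫ t in x..y, u (k + 1) t) ^ 2 := by
        rw [intervalIntegral.integral_eq_sub_of_hasDerivAt (fun t _ => hu.hasDerivAt hk t)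
          (hc.intervalIntegrable _ _)]
    _ ≤ (y - x) * ∫ t in x..y, u (k + 1) t ^ 2 := sq_intervalIntegral_le hc hxy
    _ ≤ (y - x) * ∫ t in x..y, sigmaDensity n u t := by
        refine mul_le_mul_of_nonneg_left ?_ (sub_nonneg.2 hxy)
        refine intervalIntegral.integral_mono_on hxy ((hc.pow 2).intervalIntegrable _ _)
          (intervalIntegrable_sigmaDensity hu _ _) fun t _ => ?_
        simpa using one_add_sq_pow_mul_sq_le_sigmaDensity (u := u) (j := 0) hk (by lia) t
    _ ≤ (d - c) * ∫ t in c..d, sigmaDensity n u t := by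
        gcongr
        · exact intervalIntegral.integral_nonneg hxy fun t _ => sigmaDensity_nonneg n u t
        · linarith
        · exact intervalIntegral.integral_mono_interval hcx hxy hyd
            (ae_of_all _ (sigmaDensity_nonneg n u)) (intervalIntegrable_sigmaDensity hu _ _)

lemma one_add_sq_pow_mul_abs_le (hh : 0 < h) (h1 : h ≤ 1) (hb : 0 ≤ b)
    (hu : IsPrimitiveChain n u)
    (hS : 53 * ∫ t in (a - h)..(a + h), sigmaDensity n u t ≤ h * b ^ 2) (hk : k + 1 < n)
    (hjn : 2 * j + k + 1 ≤ n) (hj : j ≤ 2) (hx : x ∈ Set.Icc (a - h) (a + h)) :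
    (1 + a ^ 2) ^ j * |u k x| ≤ 3 ^ j * b := by
  have hS0 : 0 ≤ ∫ t in (a - h)..(a + h), sigmaDensity n u t :=
    intervalIntegral.integral_nonneg (by linarith) fun t _ => sigmaDensity_nonneg n u t
  have hj' : 12 * (j : ℝ) ^ 2 + 5 ≤ 53 := by
    have : (j : ℝ) ^ 2 ≤ 2 ^ 2 := by gcongr; exact_mod_cast hj
    linarith
  have hsq : h * ((1 + x ^ 2) ^ j * u k x) ^ 2 ≤ h * b ^ 2 :=
    (mul_sq_le_integral_sigmaDensity hh.le h1 hu hk hjn hx).trans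
      ((mul_le_mul_of_nonneg_right hj' hS0).trans hS)
  have habs : |(1 + x ^ 2) ^ j * u k x| ≤ b := abs_le_of_sq_le_sq (le_of_mul_le_mul_left hsq hh) hb
  rw [abs_mul, abs_of_nonneg (by positivity)] at habs
  calc (1 + a ^ 2) ^ j * |u k x| ≤ (3 * (1 + x ^ 2)) ^ j * |u k x| := by
        gcongr
        exact one_add_sq_le_of_mem_Icc h1 hx
    _ = 3 ^ j * ((1 + x ^ 2) ^ j * |u k x|) := by rw [mul_pow, mul_assoc]
    _ ≤ 3 ^ j * b := by gcongr

end Cell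

section SymmetricDifference

variable {a h B : ℝ}

lemma hasDerivAt_add_add_sub {f f' : ℝ → ℝ} (hf : ∀ x, HasDerivAt f (f' x) x) (a t : ℝ) :
    HasDerivAt (fun t => f (a + t) + f (a - t)) (f' (a + t) - f' (a - t)) t :=
  (((hf (a + t)).comp_const_add a t).add ((hf (a - t)).comp_const_sub a t)).congr_deriv (by ring)

lemma hasDerivAt_add_sub_sub {f f' : ℝ → ℝ} (hf : ∀ x, HasDerivAt f (f' x) x) (a t : ℝ) :
    HasDerivAt (fun t => f (a + t) - f (a - t)) (f' (a + t) + f' (a - t)) t :=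
  (((hf (a + t)).comp_const_add a t).sub ((hf (a - t)).comp_const_sub a t)).congr_deriv (by ring)

lemma abs_add_add_sub_sub_le {f f' : ℝ → ℝ} (hf : ∀ x, HasDerivAt f (f' x) x) (hh : 0 ≤ h)
    (hB : ∀ t ∈ Set.Icc 0 h, |f' (a + t) - f' (a - t)| ≤ B) :
    |f (a + h) + f (a - h) - 2 * f a| ≤ B * h := by
  have := abs_sub_le_mul_of_hasDerivAt hh (hasDerivAt_add_add_sub hf a) hB
  rwa [add_zero, sub_zero, ← two_mul, sub_zero] at this

lemma abs_second_difference_le {f f' f'' : ℝ → ℝ} (hf : ∀ x, HasDerivAt f (f' x) x)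
    (hf' : ∀ x, HasDerivAt f' (f'' x) x) (hh : 0 ≤ h) (hB0 : 0 ≤ B)
    (hB : ∀ x ∈ Set.Icc (a - h) (a + h), |f'' x| ≤ B) :
    |f (a + h) + f (a - h) - 2 * f a| ≤ 2 * B * h ^ 2 := by
  have hfirst (t : ℝ) (ht : t ∈ Set.Icc 0 h) : |f' (a + t) - f' (a - t)| ≤ B * (2 * h) := by
    refine (abs_sub_le_mul_of_hasDerivAt (c := a - t) (d := a + t) (by linarith [ht.1]) hf'
      fun x hx => hB x ⟨by linarith [hx.1, ht.2], by linarith [hx.2, ht.2]⟩).trans ?_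
    gcongr
    linarith [ht.2]
  refine (abs_add_add_sub_sub_le hf hh hfirst).trans_eq (by ring)

lemma abs_second_difference_sub_le {f f' f'' f''' : ℝ → ℝ} (hf : ∀ x, HasDerivAt f (f' x) x)
    (hf' : ∀ x, HasDerivAt f' (f'' x) x) (hf'' : ∀ x, HasDerivAt f'' (f''' x) x) (hh : 0 ≤ h)
    (hB0 : 0 ≤ B) (hB : ∀ t ∈ Set.Icc 0 h, |f''' (a + t) - f''' (a - t)| ≤ B) :
    |f (a + h) + f (a - h) - 2 * f a - h ^ 2 * f'' a| ≤ B * h ^ 3 := by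
  have hsecond (t : ℝ) (ht : t ∈ Set.Icc 0 h) :
      |f'' (a + t) + f'' (a - t) - 2 * f'' a| ≤ B * h :=
    (abs_add_add_sub_sub_le hf'' ht.1 fun s hs => hB s ⟨hs.1, hs.2.trans ht.2⟩).trans <| by
      gcongr
      exact ht.2
  have hfirst (t : ℝ) (ht : t ∈ Set.Icc 0 h) :
      |f' (a + t) - f' (a - t) - 2 * t * f'' a| ≤ B * h * h := by
    have hderiv (t : ℝ) : HasDerivAt (fun t => f' (a + t) - f' (a - t) - 2 * t * f'' a)
        (f'' (a + t) + f'' (a - t) - 2 * f'' a) t := by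
      simpa using (hasDerivAt_add_sub_sub hf' a t).fun_sub
        (((hasDerivAt_id t).const_mul 2).mul_const (f'' a))
    have := abs_sub_le_mul_of_hasDerivAt ht.1 hderiv fun s hs => hsecond s ⟨hs.1, hs.2.trans ht.2⟩
    simp only [add_zero, sub_zero, sub_self, mul_zero, zero_mul] at this
    refine this.trans ?_
    gcongr
    exact ht.2
  have hderiv (t : ℝ) : HasDerivAt (fun t => f (a + t) + f (a - t) - t ^ 2 * f'' a)
      (f' (a + t) - f' (a - t) - 2 * t * f'' a) t := by
    simpa using (hasDerivAt_add_add_sub hf a t).fun_sub ((hasDerivAt_pow 2 t).mul_const (f'' a))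
  have := abs_sub_le_mul_of_hasDerivAt hh hderiv hfirst
  rw [add_zero, sub_zero, sub_zero] at this
  calc |f (a + h) + f (a - h) - 2 * f a - h ^ 2 * f'' a|
      = |f (a + h) + f (a - h) - h ^ 2 * f'' a - (f a + f a - 0 ^ 2 * f'' a)| := by
        congr 1
        ring
    _ ≤ B * h * h * h := this
    _ = B * h ^ 3 := by ring

end SymmetricDifference

section OscillatorError

variable {u : ℕ → ℝ → ℝ} {a b h : ℝ}

lemma abs_sqrt_one_add_sub_le {t : ℝ} (ht : -1 ≤ t) : |√(1 + t) - (1 + t / 2)| ≤ t ^ 2 / 2 := by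
  obtain ⟨s, hs, rfl⟩ : ∃ s, 0 ≤ s ∧ t = (s - 1) * (s + 1) :=
    ⟨√(1 + t), Real.sqrt_nonneg _, by linear_combination -Real.sq_sqrt (by linarith : 0 ≤ 1 + t)⟩
  rw [show 1 + (s - 1) * (s + 1) = s ^ 2 by ring, Real.sqrt_sq hs,
    show s - (1 + (s - 1) * (s + 1) / 2) = -((s - 1) ^ 2 / 2) by ring, abs_neg,
    abs_of_nonneg (by positivity), mul_pow]
  gcongr
  exact le_mul_of_one_le_right (sq_nonneg _) (one_le_pow₀ (by linarith))

/-- The error of the second order expansion in `h` of the coefficient of `u (a + h)` in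
`-h ^ 2 * discreteOscillator h u a`; by symmetry that of `u (a - h)` is
`coeffRemainder h (-a)`. -/
noncomputable def coeffRemainder (h a : ℝ) : ℝ :=
  √((1 + a * h + h ^ 2) * (1 - a * h)) - (1 + h ^ 2 * (1 - a ^ 2 - a * h) / 2)

lemma abs_coeffRemainder_le (hah : |a * h| ≤ 1) :
    |coeffRemainder h a| ≤ 2 * h ^ 4 * (1 + a ^ 2) ^ 2 := by
  set t := h ^ 2 * (1 - a ^ 2 - a * h)
  have hfactor : (1 + a * h + h ^ 2) * (1 - a * h) = 1 + t := by ring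
  have ht : -1 ≤ t := by
    have hnonneg : 0 ≤ (1 + a * h + h ^ 2) * (1 - a * h) :=
      mul_nonneg (by linarith [neg_le_of_abs_le hah, sq_nonneg h])
        (by linarith [le_of_abs_le hah])
    linarith
  have htabs : |t| ≤ h ^ 2 * (2 * (1 + a ^ 2)) := by
    rw [abs_mul, abs_of_nonneg (sq_nonneg h)]
    gcongr
    linarith [abs_sub (1 - a ^ 2) (a * h), abs_one_sub_sq_le a, sq_nonneg a]
  calc |coeffRemainder h a| ≤ t ^ 2 / 2 := by
        rw [coeffRemainder, hfactor]
        exact abs_sqrt_one_add_sub_le ht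
    _ = |t| ^ 2 / 2 := by rw [sq_abs]
    _ ≤ (h ^ 2 * (2 * (1 + a ^ 2))) ^ 2 / 2 := by gcongr
    _ = 2 * h ^ 4 * (1 + a ^ 2) ^ 2 := by ring

/-- The value at `a` of `H f - H_h f` for a real function `f` with second derivative `f''`. -/
noncomputable def oscillatorError (h : ℝ) (f f'' : ℝ → ℝ) (a : ℝ) : ℝ :=
  -f'' a + a ^ 2 * f a -
    if |a| ≤ 1 / h then
      -(1 / h ^ 2 * √((1 + a * h + h ^ 2) * (1 - a * h))) * f (a + h)
        - (1 / h ^ 2 * √((1 - a * h + h ^ 2) * (1 + a * h))) * f (a - h)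
        + (1 + 2 / h ^ 2) * f a
    else 0

lemma oscillatorError_of_abs_le (hh : h ≠ 0) (ha : |a| ≤ 1 / h) (f f'' : ℝ → ℝ) :
    oscillatorError h f f'' a
      = (f (a + h) + f (a - h) - 2 * f a - h ^ 2 * f'' a) / h ^ 2
        + (1 - a ^ 2) / 2 * (f (a + h) + f (a - h) - 2 * f a)
        - a * h / 2 * (f (a + h) - f (a - h))
        + (coeffRemainder h a * f (a + h) / h ^ 2
          + coeffRemainder h (-a) * f (a - h) / h ^ 2) := by
  rw [oscillatorError, if_pos ha, coeffRemainder, coeffRemainder,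
    show (1 + -a * h + h ^ 2) * (1 - -a * h) = (1 - a * h + h ^ 2) * (1 + a * h) by ring]
  field_simp
  ring

lemma oscillatorError_of_lt_abs (ha : 1 / h < |a|) (f f'' : ℝ → ℝ) :
    oscillatorError h f f'' a = -f'' a + a ^ 2 * f a := by
  rw [oscillatorError, if_neg ha.not_ge, sub_zero]

lemma abs_coeffRemainder_mul_div_le (hh : 0 < h) (hah : |a * h| ≤ 1) {y : ℝ}
    (hy : (1 + a ^ 2) ^ 2 * |y| ≤ b) : |coeffRemainder h a * y / h ^ 2| ≤ 2 * h ^ 2 * b := by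
  rw [abs_div, abs_mul, abs_of_pos (pow_pos hh 2), div_le_iff₀ (pow_pos hh 2)]
  calc |coeffRemainder h a| * |y| ≤ 2 * h ^ 4 * (1 + a ^ 2) ^ 2 * |y| := by
        gcongr
        exact abs_coeffRemainder_le hah
    _ = 2 * h ^ 4 * ((1 + a ^ 2) ^ 2 * |y|) := by ring
    _ ≤ 2 * h ^ 4 * b := by gcongr
    _ = 2 * h ^ 2 * b * h ^ 2 := by ring

lemma abs_second_difference_sub_div_le (hh : 0 < h) (hb : 0 ≤ b) (hu : IsPrimitiveChain 5 u)
    (hS : 53 * ∫ t in (a - h)..(a + h), sigmaDensity 5 u t ≤ h * b ^ 2) :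
    |(u 0 (a + h) + u 0 (a - h) - 2 * u 0 a - h ^ 2 * u 2 a) / h ^ 2| ≤ h ^ 2 * b := by
  have hthird (t : ℝ) (ht : t ∈ Set.Icc 0 h) : |u 3 (a + t) - u 3 (a - t)| ≤ h * b := by
    have hS0 : 0 ≤ ∫ t in (a - h)..(a + h), sigmaDensity 5 u t :=
      intervalIntegral.integral_nonneg (by linarith) fun t _ => sigmaDensity_nonneg 5 u t
    refine abs_le_of_sq_le_sq ?_ (by positivity)
    calc (u 3 (a + t) - u 3 (a - t)) ^ 2
        ≤ (a + h - (a - h)) * ∫ t in (a - h)..(a + h), sigmaDensity 5 u t :=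
          sq_sub_le_integral_sigmaDensity hu (by norm_num) (by linarith [ht.2])
            (by linarith [ht.1]) (by linarith [ht.2])
      _ = h * (2 * ∫ t in (a - h)..(a + h), sigmaDensity 5 u t) := by ring
      _ ≤ h * (h * b ^ 2) := mul_le_mul_of_nonneg_left (by linarith) hh.le
      _ = (h * b) ^ 2 := by ring
  rw [abs_div, abs_of_pos (pow_pos hh 2), div_le_iff₀ (pow_pos hh 2)]
  calc _ ≤ h * b * h ^ 3 :=
        abs_second_difference_sub_le (fun x => hu.hasDerivAt (by norm_num) x)
          (fun x => hu.hasDerivAt (by norm_num) x) (fun x => hu.hasDerivAt (by norm_num) x)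
          hh.le (by positivity) hthird
    _ = h ^ 2 * b * h ^ 2 := by ring

lemma abs_one_sub_sq_mul_second_difference_le {f f' f'' : ℝ → ℝ}
    (hf : ∀ x, HasDerivAt f (f' x) x) (hf' : ∀ x, HasDerivAt f' (f'' x) x) (hh : 0 ≤ h)
    (hb : 0 ≤ b) (hf'' : ∀ x ∈ Set.Icc (a - h) (a + h), (1 + a ^ 2) * |f'' x| ≤ b) :
    |(1 - a ^ 2) / 2 * (f (a + h) + f (a - h) - 2 * f a)| ≤ h ^ 2 * b := by
  have hdiff := abs_second_difference_le (B := b / (1 + a ^ 2)) hf hf' hh (by positivity)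
    fun x hx => (le_div_iff₀' (by positivity)).2 (hf'' x hx)
  rw [abs_mul, abs_div, abs_two]
  calc |1 - a ^ 2| / 2 * |f (a + h) + f (a - h) - 2 * f a|
      ≤ (1 + a ^ 2) / 2 * (2 * (b / (1 + a ^ 2)) * h ^ 2) := by
        gcongr
        exact abs_one_sub_sq_le a
    _ = h ^ 2 * b := by field_simp

lemma abs_mul_div_two_mul_sub_le {f f' : ℝ → ℝ} (hf : ∀ x, HasDerivAt f (f' x) x) (hh : 0 ≤ h)
    (hf' : ∀ x ∈ Set.Icc (a - h) (a + h), (1 + a ^ 2) * |f' x| ≤ b) :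
    |a * h / 2 * (f (a + h) - f (a - h))| ≤ h ^ 2 * b := by
  have hdiff := abs_sub_le_mul_of_hasDerivAt (B := b / (1 + a ^ 2)) (by linarith) hf
    fun x hx => (le_div_iff₀' (by positivity)).2 (hf' x hx)
  rw [abs_mul, abs_div, abs_mul, abs_of_nonneg hh, abs_two]
  calc |a| * h / 2 * |f (a + h) - f (a - h)|
      ≤ (1 + a ^ 2) * h / 2 * (b / (1 + a ^ 2) * (a + h - (a - h))) := by
        gcongr
        exact abs_le_one_add_sq a
    _ = h ^ 2 * b := by
        field_simp
        ring

lemma abs_oscillatorError_le_of_abs_le (hh : 0 < h) (h1 : h ≤ 1) (hb : 0 ≤ b)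
    (hu : IsPrimitiveChain 5 u)
    (hS : 53 * ∫ t in (a - h)..(a + h), sigmaDensity 5 u t ≤ h * b ^ 2) (ha : |a| ≤ 1 / h) :
    |oscillatorError h (u 0) (u 2) a| ≤ 43 * h ^ 2 * b := by
  have hah : |a * h| ≤ 1 := by rwa [abs_mul, abs_of_pos hh, ← le_div_iff₀ hh]
  have hu₀ (x : ℝ) (hx : x ∈ Set.Icc (a - h) (a + h)) : (1 + a ^ 2) ^ 2 * |u 0 x| ≤ 3 ^ 2 * b :=
    one_add_sq_pow_mul_abs_le hh h1 hb hu hS (by norm_num) (by norm_num) le_rfl hx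
  have hu₁ (x : ℝ) (hx : x ∈ Set.Icc (a - h) (a + h)) : (1 + a ^ 2) * |u 1 x| ≤ 3 * b := by
    simpa using one_add_sq_pow_mul_abs_le (j := 1) hh h1 hb hu hS (by norm_num) (by norm_num)
      one_le_two hx
  have hu₂ (x : ℝ) (hx : x ∈ Set.Icc (a - h) (a + h)) : (1 + a ^ 2) * |u 2 x| ≤ 3 * b := by
    simpa using one_add_sq_pow_mul_abs_le (j := 1) hh h1 hb hu hS (by norm_num) (by norm_num)
      one_le_two hx
  have htaylor := abs_second_difference_sub_div_le hh hb hu hS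
  have hsecond := abs_one_sub_sq_mul_second_difference_le
    (fun x => hu.hasDerivAt (k := 0) (by norm_num) x)
    (fun x => hu.hasDerivAt (k := 1) (by norm_num) x) hh.le (by positivity) hu₂
  have hfirst := abs_mul_div_two_mul_sub_le (fun x => hu.hasDerivAt (k := 0) (by norm_num) x)
    hh.le hu₁
  have hright := abs_coeffRemainder_mul_div_le hh hah (hu₀ (a + h) ⟨by linarith, le_rfl⟩)
  have hleft := abs_coeffRemainder_mul_div_le hh (a := -a) (by rwa [neg_mul, abs_neg])
    ((neg_sq a).symm ▸ hu₀ (a - h) ⟨le_rfl, by linarith⟩)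
  rw [oscillatorError_of_abs_le hh.ne' ha]
  refine (abs_add_le _ _).trans ((add_le_add ((abs_sub _ _).trans
    (add_le_add_left (abs_add_le _ _) _)) (abs_add_le _ _)).trans ?_)
  linarith

lemma abs_oscillatorError_le (hh : 0 < h) (h1 : h ≤ 1) (hb : 0 ≤ b)
    (hu : IsPrimitiveChain 5 u)
    (hS : 53 * ∫ t in (a - h)..(a + h), sigmaDensity 5 u t ≤ h * b ^ 2) :
    |oscillatorError h (u 0) (u 2) a| ≤ 43 * h ^ 2 * b := by
  rcases le_or_gt |a| (1 / h) with ha | ha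
  · exact abs_oscillatorError_le_of_abs_le hh h1 hb hu hS ha
  have hcenter : a ∈ Set.Icc (a - h) (a + h) := ⟨by linarith, by linarith⟩
  have hu₀ : (1 + a ^ 2) ^ 2 * |u 0 a| ≤ 3 ^ 2 * b :=
    one_add_sq_pow_mul_abs_le hh h1 hb hu hS (by norm_num) (by norm_num) le_rfl hcenter
  have hu₂ : (1 + a ^ 2) ^ 1 * |u 2 a| ≤ 3 ^ 1 * b :=
    one_add_sq_pow_mul_abs_le hh h1 hb hu hS (by norm_num) (by norm_num) one_le_two hcenter
  have hone : 1 ≤ h ^ 2 * (1 + a ^ 2) := by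
    have : 1 ≤ (|a| * h) ^ 2 := one_le_pow₀ ((div_lt_iff₀ hh).1 ha).le
    rw [mul_pow, sq_abs] at this
    linarith [sq_nonneg h]
  rw [oscillatorError_of_lt_abs ha]
  calc |-u 2 a + a ^ 2 * u 0 a| ≤ |u 2 a| + a ^ 2 * |u 0 a| :=
        (abs_add_le _ _).trans_eq (by rw [abs_neg, abs_mul, abs_sq])
    _ ≤ |u 2 a| + (1 + a ^ 2) * |u 0 a| := by
        gcongr
        exact le_add_of_nonneg_left zero_le_one
    _ ≤ h ^ 2 * (1 + a ^ 2) * (|u 2 a| + (1 + a ^ 2) * |u 0 a|) :=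
        le_mul_of_one_le_left (by positivity) hone
    _ = h ^ 2 * ((1 + a ^ 2) ^ 1 * |u 2 a| + (1 + a ^ 2) ^ 2 * |u 0 a|) := by ring
    _ ≤ h ^ 2 * (3 ^ 1 * b + 3 ^ 2 * b) := by gcongr
    _ ≤ 43 * h ^ 2 * b := by linarith [mul_nonneg (sq_nonneg h) hb]

lemma mul_oscillatorError_sq_le (a : ℝ) (hh : 0 < h) (h1 : h ≤ 1) (hu : IsPrimitiveChain 5 u) :
    h * oscillatorError h (u 0) (u 2) a ^ 2
      ≤ 43 ^ 2 * 53 * h ^ 4 * ∫ t in (a - h)..(a + h), sigmaDensity 5 u t := by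
  set S := ∫ t in (a - h)..(a + h), sigmaDensity 5 u t
  have hS0 : 0 ≤ S :=
    intervalIntegral.integral_nonneg (by linarith) fun x _ => sigmaDensity_nonneg 5 u x
  have hb : h * √(53 * S / h) ^ 2 = 53 * S := by
    rw [Real.sq_sqrt (by positivity), mul_div_cancel₀ _ hh.ne']
  calc h * oscillatorError h (u 0) (u 2) a ^ 2
      = h * |oscillatorError h (u 0) (u 2) a| ^ 2 := by rw [sq_abs]
    _ ≤ h * (43 * h ^ 2 * √(53 * S / h)) ^ 2 := by
        gcongr
        exact abs_oscillatorError_le hh h1 (Real.sqrt_nonneg _) hu hb.ge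
    _ = 43 ^ 2 * h ^ 4 * (h * √(53 * S / h) ^ 2) := by ring
    _ = 43 ^ 2 * 53 * h ^ 4 * S := by
        rw [hb]
        ring

lemma tsum_mul_oscillatorError_sq_le (hh : 0 < h) (h1 : h ≤ 1) (hu : IsPrimitiveChain 5 u) :
    ∑' k : ℤ, ENNReal.ofReal (h * oscillatorError h (u 0) (u 2) (k * h) ^ 2)
      ≤ ENNReal.ofReal (2 * (43 ^ 2 * 53 * h ^ 4))
        * ∫⁻ x, ENNReal.ofReal (sigmaDensity 5 u x) :=
  tsum_ofReal_le_of_le_integral hh (continuous_sigmaDensity hu).locallyIntegrable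
    (sigmaDensity_nonneg 5 u) (by positivity) fun k => mul_oscillatorError_sq_le (k * h) hh h1 hu

end OscillatorError

/-! ### The norm of `Σⁿ` -/

lemma eLpNorm_two_sq (f : ℝ → ℂ) : eLpNorm f 2 ^ 2 = ∫⁻ x, ‖f x‖ₑ ^ 2 := by
  simpa using eLpNorm_nnreal_pow_eq_lintegral (f := f) (μ := volume) (p := 2) two_ne_zero

lemma enorm_ofReal_add_ofReal_mul_I_sq (x y : ℝ) :
    ‖(x + y * Complex.I : ℂ)‖ₑ ^ 2 = ENNReal.ofReal (x ^ 2) + ENNReal.ofReal (y ^ 2) := by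
  rw [← ofReal_norm, ← ENNReal.ofReal_pow (norm_nonneg _), Complex.sq_norm,
    Complex.normSq_add_mul_I, ENNReal.ofReal_add (sq_nonneg _) (sq_nonneg _)]

lemma lintegral_sq_add_lintegral_sq_eq_eLpNorm_sq {f : ℝ → ℂ} {u v : ℝ → ℝ}
    (hf : f =ᵐ[volume] fun x => u x + v x * Complex.I) (hu : AEMeasurable u) :
    (∫⁻ x, ENNReal.ofReal (u x ^ 2)) + (∫⁻ x, ENNReal.ofReal (v x ^ 2)) = eLpNorm f 2 ^ 2 := by
  rw [eLpNorm_congr_ae hf, eLpNorm_two_sq, ← lintegral_add_left' (hu.pow_const 2).ennreal_ofReal]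
  simp only [enorm_ofReal_add_ofReal_mul_I_sq]

lemma continuous_japanese : Continuous japanese := by
  unfold japanese
  fun_prop

lemma lintegral_weight_mul_sq_add_eq_eLpNorm_sq {f : ℝ → ℂ} {u v : ℝ → ℝ}
    (hf : f =ᵐ[volume] fun x => u x + v x * Complex.I) (hu : AEMeasurable u) (n : ℕ) :
    (∫⁻ x, ENNReal.ofReal ((1 + x ^ 2) ^ n * u x ^ 2))
      + (∫⁻ x, ENNReal.ofReal ((1 + x ^ 2) ^ n * v x ^ 2))
      = eLpNorm (fun x => japanese x ^ n • f x) 2 ^ 2 := by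
  have hsq (x y : ℝ) : (1 + x ^ 2) ^ n * y ^ 2 = (japanese x ^ n * y) ^ 2 := by
    rw [mul_pow, ← pow_mul, mul_comm n, pow_mul, japanese_sq]
  simp only [hsq]
  refine lintegral_sq_add_lintegral_sq_eq_eLpNorm_sq ?_
    ((continuous_japanese.pow n).aemeasurable.mul hu)
  filter_upwards [hf] with x hx
  rw [hx, Complex.real_smul]
  push_cast
  ring

lemma eLpNorm_weakDeriv_le_sobolevNorm (n : ℕ) (g : ℝ → ℂ) :
    eLpNorm (weakDeriv n g) 2 ≤ sobolevNorm n g := by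
  rw [sobolevNorm, one_div, ENNReal.le_rpow_inv_iff two_pos, ENNReal.rpow_ofNat,
    Finset.sum_range_succ]
  exact le_add_self

lemma eLpNorm_sq_add_eLpNorm_weakDeriv_sq_le_sigmaNorm_sq (n : ℕ) (g : ℝ → ℂ) :
    eLpNorm (fun x => japanese x ^ n • g x) 2 ^ 2 + eLpNorm (weakDeriv n g) 2 ^ 2
      ≤ sigmaNorm n g ^ 2 := by
  rw [add_comm, sigmaNorm, add_sq']
  exact (add_le_add_left (pow_le_pow_left' (eLpNorm_weakDeriv_le_sobolevNorm n g) 2) _).trans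
    le_self_add

lemma MemSigma.exists_isPrimitiveChain {n : ℕ} {g : ℝ → ℂ} (hg : MemSigma n g) :
    ∃ U V : ℕ → ℝ → ℝ, IsPrimitiveChain n U ∧ IsPrimitiveChain n V ∧
      (∀ k ≤ n, MemLp (U k) 2) ∧ (∀ k ≤ n, MemLp (V k) 2) ∧
      (g =ᵐ[volume] fun x => U 0 x + V 0 x * Complex.I) ∧
      ∀ k ≤ n, weakDeriv k g =ᵐ[volume] fun x => U k x + V k x * Complex.I := by
  have hweak (k : ℕ) (hk : k ≤ n) := hg.1.isWeakDeriv_weakDeriv hk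
  have hLp (k : ℕ) (hk : k ≤ n) := hg.1.memLp_weakDeriv hk
  obtain ⟨U, hgU, hU⟩ := IsWeakDeriv.exists_isPrimitive_chain hweak Complex.reCLM
  obtain ⟨V, hgV, hV⟩ := IsWeakDeriv.exists_isPrimitive_chain hweak Complex.imCLM
  have hgUV (k : ℕ) (hk : k ≤ n) :
      weakDeriv k g =ᵐ[volume] fun x => U k x + V k x * Complex.I := by
    filter_upwards [hgU k hk, hgV k hk] with x hre him
    rw [← hre, ← him]
    exact (Complex.re_add_im _).symm
  exact ⟨U, V, hU, hV,
    fun k hk => (memLp_congr_ae (hgU k hk)).1 (Complex.reCLM.comp_memLp' (hLp k hk)),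
    fun k hk => (memLp_congr_ae (hgV k hk)).1 (Complex.imCLM.comp_memLp' (hLp k hk)),
    ((hweak 0 n.zero_le).ae_eq_of_zero (hg.1.1.locallyIntegrable one_le_two)).trans
      (hgUV 0 n.zero_le), hgUV⟩

lemma exists_lintegral_sigmaDensity_add_le_sigmaNorm_sq (n : ℕ) :
    ∃ C, 0 ≤ C ∧ ∀ g, MemSigma n g → ∃ U V : ℕ → ℝ → ℝ,
      IsPrimitiveChain n U ∧ IsPrimitiveChain n V ∧
      (g =ᵐ[volume] fun x => U 0 x + V 0 x * Complex.I) ∧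
      (∀ k ≤ n, weakDeriv k g =ᵐ[volume] fun x => U k x + V k x * Complex.I) ∧
      (∫⁻ x, ENNReal.ofReal (sigmaDensity n U x)) + (∫⁻ x, ENNReal.ofReal (sigmaDensity n V x))
        ≤ ENNReal.ofReal C * sigmaNorm n g ^ 2 := by
  obtain ⟨C, hC, hle⟩ := exists_lintegral_sigmaDensity_le n
  refine ⟨C, hC, fun g hg => ?_⟩
  obtain ⟨U, V, hU, hV, hULp, hVLp, hg0, hgk⟩ := hg.exists_isPrimitiveChain
  refine ⟨U, V, hU, hV, hg0, hgk, (add_le_add (hle U hU hULp) (hle V hV hVLp)).trans ?_⟩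
  rw [← mul_add, add_add_add_comm,
    lintegral_weight_mul_sq_add_eq_eLpNorm_sq hg0 (hULp 0 n.zero_le).1.aemeasurable,
    lintegral_sq_add_lintegral_sq_eq_eLpNorm_sq (hgk n le_rfl) (hULp n le_rfl).1.aemeasurable]
  gcongr
  exact eLpNorm_sq_add_eLpNorm_weakDeriv_sq_le_sigmaNorm_sq n g

lemma gridProj_sub_discreteOscillator_apply {g : ℝ → ℂ} {f₁ f₁'' f₂ f₂'' : ℝ → ℝ}
    (hf₁ : Continuous f₁) (hf₁'' : Continuous f₁'') (hf₂ : Continuous f₂)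
    (hf₂'' : Continuous f₂'') (hg : g =ᵐ[volume] fun x => f₁ x + f₂ x * Complex.I)
    (hg'' : weakDeriv 2 g =ᵐ[volume] fun x => f₁'' x + f₂'' x * Complex.I)
    (h : ℝ) (a : Grid h) :
    (gridProj h (harmonicOscillator g) - discreteOscillator h (gridProj h g)) a
      = oscillatorError h f₁ f₁'' a + oscillatorError h f₂ f₂'' a * Complex.I := by
  have hrep : contRep g = fun x => f₁ x + f₂ x * Complex.I := contRep_eq (by fun_prop) hg
  have hHrep : contRep (harmonicOscillator g) = fun x =>
      -(f₁'' x + f₂'' x * Complex.I) + (x : ℂ) ^ 2 * (f₁ x + f₂ x * Complex.I) := by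
    refine contRep_eq (by fun_prop) ?_
    filter_upwards [hg, hg''] with x hx hx''
    rw [harmonicOscillator, hx, hx'']
  have hstep : (step h : ℝ) = h := rfl
  rw [Pi.sub_apply, gridProj, hHrep, discreteOscillator]
  simp only [gridProj, hrep, oscillatorError, AddSubgroup.coe_add, AddSubgroup.coe_sub, hstep]
  split_ifs <;>
  · push_cast
    ring

theorem exists_ell2Norm_sub_discreteOscillator_le :
    ∃ C : ℝ, ∀ h : ℝ, 0 < h → h ≤ 1 → ∀ g : ℝ → ℂ, MemSigma 5 g →
      ell2Norm h (gridProj h (harmonicOscillator g) - discreteOscillator h (gridProj h g))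
        ≤ ENNReal.ofReal (C * h ^ 2) * sigmaNorm 5 g := by
  obtain ⟨C, hC, hchain⟩ := exists_lintegral_sigmaDensity_add_le_sigmaNorm_sq 5
  refine ⟨√(2 * (43 ^ 2 * 53) * C), fun h hh h1 g hg => ?_⟩
  obtain ⟨U, V, hU, hV, hg0, hgk, hle⟩ := hchain g hg
  have herror (k : ℤ) : ENNReal.ofReal (h * ‖(gridProj h (harmonicOscillator g)
        - discreteOscillator h (gridProj h g)) (gridEquiv hh k)‖ ^ 2)
      = ENNReal.ofReal (h * oscillatorError h (U 0) (U 2) (k * h) ^ 2)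
        + ENNReal.ofReal (h * oscillatorError h (V 0) (V 2) (k * h) ^ 2) := by
    rw [gridProj_sub_discreteOscillator_apply (hU.continuous (by norm_num))
      (hU.continuous (by norm_num)) (hV.continuous (by norm_num)) (hV.continuous (by norm_num))
      hg0 (hgk 2 (by norm_num)), coe_gridEquiv, Complex.sq_norm, Complex.normSq_add_mul_I,
      mul_add, ENNReal.ofReal_add (by positivity) (by positivity)]
  apply ell2Norm_le_of_tsum_le_sq hh
  simp_rw [herror]
  rw [ENNReal.tsum_add]
  set c := ENNReal.ofReal (2 * (43 ^ 2 * 53 * h ^ 4)) with hc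
  calc _ ≤ c * (∫⁻ x, ENNReal.ofReal (sigmaDensity 5 U x))
        + c * ∫⁻ x, ENNReal.ofReal (sigmaDensity 5 V x) :=
        add_le_add (tsum_mul_oscillatorError_sq_le hh h1 hU)
          (tsum_mul_oscillatorError_sq_le hh h1 hV)
    _ ≤ c * (ENNReal.ofReal C * sigmaNorm 5 g ^ 2) := by
        rw [← mul_add]
        gcongr
    _ = (ENNReal.ofReal (√(2 * (43 ^ 2 * 53) * C) * h ^ 2) * sigmaNorm 5 g) ^ 2 := by
        rw [mul_pow, ← ENNReal.ofReal_pow (by positivity), mul_pow, Real.sq_sqrt (by positivity),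
          hc, ← mul_assoc, ← ENNReal.ofReal_mul (by positivity)]
        ring_nf

end Kravchuk

open Kravchuk in
theorem theorem2_general :
    (∃ C : ℝ, ∀ h : ℝ, 0 < h → h ≤ 1 → ∀ g : ℝ → ℂ, MemSigma 5 g →
      ell2Norm h (gridProj h (harmonicOscillator g) - discreteOscillator h (gridProj h g))
        ≤ ENNReal.ofReal (C * h ^ 2) * sigmaNorm 5 g) ∧
    (∀ δ : ℝ, 0 < δ → ∀ σ : ℝ,
      ∃ (C : ℝ) (N₀ : ℕ), ∀ N : ℕ, N₀ ≤ N → Even N → ∀ h : ℝ, h = mesh N →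
        ell2Norm h
            (fun a => ((japanese a ^ σ *
              (rho h a - 1 / √Real.pi * Real.exp (-(a : ℝ) ^ 2)) : ℝ) : ℂ))
          ≤ ENNReal.ofReal (C * h ^ (2 - δ)) ∧
        ∀ n : ℕ, (n : ℝ) ≤ 1 / 3 * δ * |Real.log h| →
          ell2Norm h
              (fun a => ((japanese a ^ σ : ℝ) : ℂ) *
                ((kravchukFun n h a : ℂ)
                  - gridProj h (fun x => (hermiteFun n x : ℂ)) a))
            ≤ ENNReal.ofReal (C * h ^ (2 - δ))) :=
  ⟨exists_ell2Norm_sub_discreteOscillator_le, fun _ hδ σ => kravchuk_convergence hδ σ⟩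

theorem theorem2 :
    (∃ (C : ℝ) (N₀ : ℕ), ∀ N : ℕ, N₀ ≤ N → Even N → ∀ h : ℝ, h = Kravchuk.mesh N →
      ∀ g : ℝ → ℂ, Kravchuk.MemSigma 5 g →
        Kravchuk.ell2Norm h
            (Kravchuk.gridProj h (Kravchuk.harmonicOscillator g)
              - Kravchuk.discreteOscillator h (Kravchuk.gridProj h g))
          ≤ ENNReal.ofReal (C * h ^ 2) * Kravchuk.sigmaNorm 5 g) ∧
    (∀ δ : ℝ, 0 < δ → δ < 1 → ∀ σ : ℝ, 0 ≤ σ →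
      ∃ (C : ℝ) (N₀ : ℕ), ∀ N : ℕ, N₀ ≤ N → Even N → ∀ h : ℝ, h = Kravchuk.mesh N →
        Kravchuk.ell2Norm h
            (fun a => ((Kravchuk.japanese a ^ σ *
              (Kravchuk.rho h a - 1 / √Real.pi * Real.exp (-(a : ℝ) ^ 2)) : ℝ) : ℂ))
          ≤ ENNReal.ofReal (C * h ^ (2 - δ)) ∧
        ∀ n : ℕ, (n : ℝ) ≤ 1 / 3 * δ * |Real.log h| →
          Kravchuk.ell2Norm h
              (fun a => ((Kravchuk.japanese a ^ σ : ℝ) : ℂ) *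
                ((Kravchuk.kravchukFun n h a : ℂ)
                  - Kravchuk.gridProj h (fun x => (Kravchuk.hermiteFun n x : ℂ)) a))
            ≤ ENNReal.ofReal (C * h ^ (2 - δ))) := by
  obtain ⟨⟨C, hC⟩, hKravchuk⟩ := theorem2_general
  exact ⟨⟨C, 2, fun N hN _ h hh =>
      hC h (hh ▸ Kravchuk.mesh_pos (by omega)) (hh ▸ Kravchuk.mesh_le_one hN)⟩,
    fun δ hδ _ σ _ => hKravchuk δ hδ σ⟩
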